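/- Let $M$ be a connected complete finite-dimensional smooth Riemannian manifold (possibly with boundary) with distance $d$, and let $1\le r\le\infty$. A Filippov system $Z$ of class $C^r$ on $M$ consists of a $C^r$ function $h\colon M\to\mathbb R$ having $0$ as a regular value and with $\Sigma=h^{-1}(0)$ compact, and of two $C^r$ vector fields $Z_+,Z_-$ on $M$; it defines the multivalued field $$Z(p)=\frac{Z_+(p)+Z_-(p)}2+\operatorname{sgn}(h(p))\,\frac{Z_+(p)-Z_-(p)}2 ,$$ where $\operatorname{sgn}(0)=[-1,1]$. Assume that $Z$ is bounded, that is, $\sup\{\|v\| : p\in M,\ v\in Z(p)\}<\infty$. A solution of $Z$ (in the sense of Filippov) on a nondegenerate interval $J\subseteq\mathbb R$ is a locally Lipschitz (equivalently, locally absolutely continuous) curve $\gamma\colon J\to M$ with $\gamma'(t)\in Z(\gamma(t))$ for almost every $t\in J$. An orbit is a solution that is maximal, i.e. not the restriction of a solution on a strictly larger interval; its maximal interval $I_\gamma$ is closed, and $\bar\gamma\colon\mathbb R\to M$ denotes the extension of $\gamma$ that is constant before the left and after the right end point of $I_\gamma$, where these are finite. The orbit space $\widetilde M$ is the set of all orbits,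 with the distance $$\tilde d(\gamma_0,\gamma_1)=\sum_{i\in\mathbb Z}\frac1{2^{|i|}}\int_i^{i+1} d(\bar\gamma_0(t),\bar\gamma_1(t))\,dt ,$$ and the flow $\widetilde\Phi$ on $\widetilde M$ is the translation $\widetilde\Phi^t(\gamma)(s)=\gamma(t+s)$, where $\widetilde\Phi^t(\gamma)$ has the interval of definition $I_\gamma-t$. Then the following are equivalent: 1. $\widetilde\Phi$ is topologically transitive: for all nonempty open sets $U,V\subseteq\widetilde M$ there is $t>0$ with $\widetilde\Phi^t(U)\cap V\neq\emptyset$; 2. $\widetilde\Phi$ is transitive: there is $\gamma\in\widetilde M$ whose (forward) orbit $\{\widetilde\Phi^t(\gamma): t\ge 0\}$ is dense in $\widetilde M$. -/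

import Mathlib

open scoped Manifold ContDiff Topology ENNReal Bundle

noncomputable section

/-- The multivalued sign: `1` on positive numbers, `-1` on negative numbers, and the whole interval
`[-1, 1]` at `0`. -/
def multiSign (x : ℝ) : Set ℝ :=
  if 0 < x then {1} else if x < 0 then {-1} else Set.Icc (-1) 1

/-- A nonsmooth vector field of class `C^r` on `M` in the sense of Filippov: a switching function `h`
with regular value `0` and compact switching manifold `h = 0`, and two vector fields, one for the
region `0 < h` and one for the region `h < 0`. -/
structure FilippovSystem {E : Type*} [NormedAddCommGroup E] [NormedSpace ℝ E] {H : Type*}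
    [TopologicalSpace H] (I : ModelWithCorners ℝ E H) (M : Type*) [TopologicalSpace M]
    [ChartedSpace H M] [IsManifold I 1 M] (r : ℕ∞) where
  h : M → ℝ
  Zplus : (p : M) → TangentSpace I p
  Zminus : (p : M) → TangentSpace I p
  contMDiff_h : ContMDiff I 𝓘(ℝ, ℝ) r h
  regular_h : ∀ p, h p = 0 → mfderiv I 𝓘(ℝ, ℝ) h p ≠ 0
  isCompact_switching : IsCompact {p | h p = 0}
  contMDiff_Zplus : ContMDiff I I.tangent r (fun p ↦ (⟨p, Zplus p⟩ : TangentBundle I M))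
  contMDiff_Zminus : ContMDiff I I.tangent r (fun p ↦ (⟨p, Zminus p⟩ : TangentBundle I M))

namespace FilippovSystem

section Basic

variable {E : Type*} [NormedAddCommGroup E] [NormedSpace ℝ E] {H : Type*} [TopologicalSpace H]
  {I : ModelWithCorners ℝ E H} {M : Type*} [MetricSpace M] [ChartedSpace H M] [IsManifold I 1 M]
  {r : ℕ∞}

/-- The multivalued field
`Z(p) = (Z₊(p) + Z₋(p)) / 2 + sgn(h(p)) (Z₊(p) - Z₋(p)) / 2`. It is `Z₊` where `0 < h`, `Z₋` where
`h < 0`, and the segment between `Z₊(p)` and `Z₋(p)` on the switching manifold. -/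
def field (Z : FilippovSystem I M r) (p : M) : Set (TangentSpace I p) :=
  {v | ∃ s ∈ multiSign (Z.h p),
    v = (1 / 2 : ℝ) • (Z.Zplus p + Z.Zminus p) + (s / 2) • (Z.Zplus p - Z.Zminus p)}

/-- The multivalued field is bounded for the Riemannian norm. -/
def IsBounded [Bundle.RiemannianBundle (fun x : M ↦ TangentSpace I x)]
    (Z : FilippovSystem I M r) : Prop :=
  ∃ C : ℝ, ∀ p : M, ∀ v ∈ Z.field p, ‖v‖ ≤ C

/-- `γ` is a Filippov solution on the time set `J`: it is locally Lipschitz on `J` and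
`γ'(t) ∈ Z(γ(t))` for almost every `t ∈ J`. (As `Z` is locally bounded, asking for local absolute
continuity instead of the local Lipschitz property gives the same curves.) -/
def IsSolutionOn (Z : FilippovSystem I M r) (γ : ℝ → M) (J : Set ℝ) : Prop :=
  LocallyLipschitzOn J γ ∧
    ∀ᵐ t : ℝ, t ∈ J → ∃ v ∈ Z.field (γ t),
      HasMFDerivWithinAt 𝓘(ℝ, ℝ) I γ J t ((1 : ℝ →L[ℝ] ℝ).smulRight v)

/-- `γ` is a solution on the nondegenerate interval `J` which no solution on a larger interval
extends. -/
structure IsMaximalSolutionOn (Z : FilippovSystem I M r) (γ : ℝ → M) (J : Set ℝ) : Prop where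
  ordConnected : J.OrdConnected
  nontrivial : J.Nontrivial
  isSolutionOn : Z.IsSolutionOn γ J
  maximal : ∀ (γ' : ℝ → M) (J' : Set ℝ), J'.OrdConnected → J ⊆ J' → Z.IsSolutionOn γ' J' →
    Set.EqOn γ γ' J → J' ⊆ J

/-- A point of the orbit space: a maximal solution, recorded by its maximal interval of definition
`domain` and by its stationary extension `curve : ℝ → M`, the continuous curve which is the solution
on `domain`, and which is constant after the right end point and constant before the left end point
of `domain`, if these are finite. -/
@[ext]
structure Orbit (Z : FilippovSystem I M r) where
  domain : Set ℝ
  curve : ℝ → M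
  isMaximal : Z.IsMaximalSolutionOn curve domain
  continuous_curve : Continuous curve
  stationary_after : ∀ s ∈ upperBounds domain, ∀ t ∈ upperBounds domain, curve s = curve t
  stationary_before : ∀ s ∈ lowerBounds domain, ∀ t ∈ lowerBounds domain, curve s = curve t

/-- The orbit distance `∑_{i ∈ ℤ} 2^{-|i|} ∫_i^{i+1} d(γ₀(t), γ₁(t)) dt`. -/
def orbitEDist {Z : FilippovSystem I M r} (γ₀ γ₁ : Z.Orbit) : ℝ≥0∞ :=
  ∑' i : ℤ, (2⁻¹ : ℝ≥0∞) ^ i.natAbs *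
    ∫⁻ t in Set.Icc (i : ℝ) (i + 1), edist (γ₀.curve t) (γ₁.curve t)

instance (Z : FilippovSystem I M r) : PseudoEMetricSpace Z.Orbit where
  edist := orbitEDist
  edist_self γ := by simp [orbitEDist]
  edist_comm γ₀ γ₁ := by simp [orbitEDist, edist_comm]
  edist_triangle γ₀ γ₁ γ₂ := by
    unfold orbitEDist
    rw [← ENNReal.tsum_add]
    refine ENNReal.tsum_le_tsum fun i ↦ ?_
    rw [← mul_add, ← MeasureTheory.lintegral_add_left
      (γ₀.continuous_curve.edist γ₁.continuous_curve).measurable]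
    gcongr
    exact edist_triangle _ _ _

theorem IsSolutionOn.shift {Z : FilippovSystem I M r} {γ : ℝ → M} {J : Set ℝ}
    (hγ : Z.IsSolutionOn γ J) (t : ℝ) :
    Z.IsSolutionOn (fun s ↦ γ (t + s)) ((fun s ↦ t + s) ⁻¹' J) := by
  constructor
  · intro x hx
    obtain ⟨K, u, hu, hK⟩ := hγ.1 hx
    refine ⟨K, (fun s ↦ t + s) ⁻¹' u, ?_, ?_⟩
    · have hc : ContinuousWithinAt (fun s : ℝ ↦ t + s) ((fun s ↦ t + s) ⁻¹' J) x := by fun_prop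
      exact hc.tendsto_nhdsWithin (Set.mapsTo_preimage _ _) hu
    · intro a ha b hb
      simpa using hK ha hb
  · have h := (MeasureTheory.measurePreserving_add_left MeasureTheory.volume t).quasiMeasurePreserving.ae
      hγ.2
    filter_upwards [h] with s hs hsJ
    obtain ⟨v, hv, hd⟩ := hs hsJ
    refine ⟨v, hv, ?_⟩
    have h1 : HasMFDerivWithinAt 𝓘(ℝ, ℝ) 𝓘(ℝ, ℝ) (fun s : ℝ ↦ t + s) ((fun s ↦ t + s) ⁻¹' J) s
        (ContinuousLinearMap.id ℝ ℝ) :=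
      ((hasFDerivAt_id (𝕜 := ℝ) s).const_add t).hasFDerivWithinAt.hasMFDerivWithinAt
    have h2 := HasMFDerivWithinAt.comp (I' := 𝓘(ℝ, ℝ)) s hd h1 (Set.mapsTo_preimage _ _)
    exact h2

theorem IsMaximalSolutionOn.shift {Z : FilippovSystem I M r} {γ : ℝ → M} {J : Set ℝ}
    (hγ : Z.IsMaximalSolutionOn γ J) (t : ℝ) :
    Z.IsMaximalSolutionOn (fun s ↦ γ (t + s)) ((fun s ↦ t + s) ⁻¹' J) where
  ordConnected := hγ.ordConnected.preimage_mono fun a b hab ↦ by simpa using hab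
  nontrivial := by
    obtain ⟨a, ha, b, hb, hab⟩ := hγ.nontrivial
    exact ⟨a - t, by simpa using ha, b - t, by simpa using hb, by simpa using hab⟩
  isSolutionOn := hγ.isSolutionOn.shift t
  maximal γ' J' hJ' hsub hsol heq := by
    have key := hγ.maximal (fun s ↦ γ' (-t + s)) ((fun s ↦ -t + s) ⁻¹' J')
      (hJ'.preimage_mono fun a b hab ↦ by simpa using hab)
      (fun a ha ↦ hsub (by simpa using ha)) (hsol.shift (-t))
      (fun a ha ↦ by simpa using heq (x := -t + a) (by simpa using ha))
    intro s hs
    exact key (by simpa using hs)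

/-- The flow on the orbit space: `Φ^t(γ)(s) = γ(t + s)`, with interval of definition translated
accordingly. -/
def orbitFlow (Z : FilippovSystem I M r) (t : ℝ) (γ : Z.Orbit) : Z.Orbit where
  domain := (fun s ↦ t + s) ⁻¹' γ.domain
  curve s := γ.curve (t + s)
  isMaximal := γ.isMaximal.shift t
  continuous_curve := γ.continuous_curve.comp (by fun_prop)
  stationary_after a ha b hb := by
    refine γ.stationary_after _ (fun s hs ↦ ?_) _ (fun s hs ↦ ?_)
    · linarith [ha (a := s - t) (by simpa using hs)]
    · linarith [hb (a := s - t) (by simpa using hs)]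
  stationary_before a ha b hb := by
    refine γ.stationary_before _ (fun s hs ↦ ?_) _ (fun s hs ↦ ?_)
    · linarith [ha (a := s - t) (by simpa using hs)]
    · linarith [hb (a := s - t) (by simpa using hs)]

end Basic

end FilippovSystem

/-- For all nonempty open `U`, `V` there is `t > 0` such that `Φ^t(U)` meets `V`. -/
def IsTopologicallyTransitiveFlow {X : Type*} [TopologicalSpace X] (Φ : ℝ → X → X) : Prop :=
  ∀ U V : Set X, IsOpen U → IsOpen V → U.Nonempty → V.Nonempty →
    ∃ t : ℝ, 0 < t ∧ (Φ t '' U ∩ V).Nonempty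

/-- Some (forward) orbit `{Φ^t(x) : t ≥ 0}` is dense. -/
def IsTransitiveFlow {X : Type*} [TopologicalSpace X] (Φ : ℝ → X → X) : Prop :=
  ∃ x : X, Dense ((fun t ↦ Φ t x) '' Set.Ici 0)

end

noncomputable section

open scoped NNReal
open Set Filter MeasureTheory Metric

theorem isContinuousRiemannianBundle_of_isContMDiffRiemannianBundle
    {E : Type*} [NormedAddCommGroup E] [NormedSpace ℝ E]
    {H : Type*} [TopologicalSpace H] (I : ModelWithCorners ℝ E H)
    (M : Type*) [TopologicalSpace M] [ChartedSpace H M] [IsManifold I ∞ M]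
    [Bundle.RiemannianBundle (fun x : M ↦ TangentSpace I x)]
    [h : IsContMDiffRiemannianBundle I ∞ E (fun x : M ↦ TangentSpace I x)] :
    IsContinuousRiemannianBundle E (fun x : M ↦ TangentSpace I x) := by
  obtain ⟨g, hg, hg'⟩ := h.exists_contMDiff
  exact ⟨g, hg.continuous, hg'⟩

/-- A Lipschitz function whose derivative is almost everywhere at most `A` grows at rate at most
`A`. -/
theorem LipschitzOnWith.sub_le_mul_of_ae_deriv_le {f : ℝ → ℝ} {K : ℝ≥0} {a b A : ℝ} (hab : a ≤ b)
    (hf : LipschitzOnWith K f (Icc a b)) (hA : ∀ᵐ t, t ∈ Ioo a b → deriv f t ≤ A) :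
    f b - f a ≤ A * (b - a) := by
  have hac : AbsolutelyContinuousOnInterval f a b :=
    LipschitzOnWith.absolutelyContinuousOnInterval (K := K) (by rwa [uIcc_of_le hab])
  rw [← hac.integral_deriv_eq_sub]
  calc ∫ x in a..b, deriv f x ≤ ∫ x in a..b, A := by
        refine intervalIntegral.integral_mono_ae_restrict hab hac.intervalIntegrable_deriv
          intervalIntegrable_const ?_
        rw [← restrict_Ioo_eq_restrict_Icc, EventuallyLE, ae_restrict_iff' measurableSet_Ioo]
        exact hA
    _ = A * (b - a) := by simp [mul_comm]

/-- A Lipschitz curve with almost everywhere speed at most `K` is `K`-Lipschitz. -/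
theorem LipschitzOnWith.dist_le_of_ae_speed_le {X : Type*} [PseudoMetricSpace X] {γ : ℝ → X}
    {C : ℝ≥0} {K a b : ℝ} (hK : 0 ≤ K) (hab : a ≤ b) (hγ : LipschitzOnWith C γ (Icc a b))
    (h : ∀ᵐ t, t ∈ Ioo a b → ∀ᶠ s in 𝓝 t, dist (γ s) (γ t) ≤ K * |s - t|) :
    dist (γ a) (γ b) ≤ K * (b - a) := by
  have hf : LipschitzOnWith (1 * C) (fun s ↦ dist (γ a) (γ s)) (Icc a b) :=
    (LipschitzWith.dist_right (γ a)).comp_lipschitzOnWith hγ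
  have key := hf.sub_le_mul_of_ae_deriv_le (A := K) hab (by
    filter_upwards [h] with t ht hmem
    refine (le_abs_self _).trans ((Real.norm_eq_abs _).symm.trans_le (norm_deriv_le_of_lip' hK ?_))
    filter_upwards [ht hmem] with s hs
    refine le_trans ?_ hs
    rw [Real.norm_eq_abs, dist_comm (γ a), dist_comm (γ a)]
    exact abs_dist_sub_le _ _ _)
  simpa using key

section Manifold

variable {E : Type*} [NormedAddCommGroup E] [NormedSpace ℝ E] {H : Type*} [TopologicalSpace H]
  {I : ModelWithCorners ℝ E H} {M : Type*} [TopologicalSpace M] [ChartedSpace H M]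
  [IsManifold I 1 M]

theorem trivializationAt_continuousLinearMapAt_self (x : M) (v : TangentSpace I x) :
    (trivializationAt E (TangentSpace I) x).continuousLinearMapAt ℝ x v = v := by
  rw [TangentBundle.continuousLinearMapAt_trivializationAt_eq_core (mem_chart_source H x)]
  exact tangentCoordChange_self (I := I) (mem_extChartAt_source x)

theorem HasMFDerivAt.hasDerivAt_extChartAt_comp {γ : ℝ → M} {t : ℝ} {v : TangentSpace I (γ t)}
    (h : HasMFDerivAt 𝓘(ℝ, ℝ) I γ t ((1 : ℝ →L[ℝ] ℝ).smulRight v)) {x : M}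
    (hx : γ t ∈ (chartAt H x).source) :
    HasDerivAt (fun s ↦ extChartAt I x (γ s))
      ((trivializationAt E (TangentSpace I) x).continuousLinearMapAt ℝ (γ t) v) t := by
  have h1 := ((mdifferentiableAt_extChartAt (I := I) hx).hasMFDerivAt.comp t h).hasFDerivAt
  rw [← TangentBundle.continuousLinearMapAt_trivializationAt hx] at h1
  let A : E →L[ℝ] E := (trivializationAt E (TangentSpace I) x).continuousLinearMapAt ℝ (γ t)
  let w : E := v
  have h2 : HasFDerivAt (𝕜 := ℝ) (E := ℝ) (F := E) (fun s ↦ extChartAt I x (γ s))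
    (A.comp ((1 : ℝ →L[ℝ] ℝ).smulRight w)) t := h1
  have h3 : HasDerivAt (fun s ↦ extChartAt I x (γ s)) (A w) t := by simpa using h2.hasDerivAt
  exact h3

omit [IsManifold I 1 M] in
theorem MDifferentiableAt.hasMFDerivAt_smulRight {γ : ℝ → M} {t : ℝ}
    (h : MDifferentiableAt 𝓘(ℝ, ℝ) I γ t) :
    HasMFDerivAt 𝓘(ℝ, ℝ) I γ t
      ((1 : ℝ →L[ℝ] ℝ).smulRight (mfderiv 𝓘(ℝ, ℝ) I γ t (1 : ℝ))) := by
  have key : ∀ A : ℝ →L[ℝ] E, A = (1 : ℝ →L[ℝ] ℝ).smulRight (A 1) := fun A ↦ by ext; simp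
  exact h.hasMFDerivAt.congr_mfderiv (key _)

end Manifold

section Riemannian

variable {E : Type*} [NormedAddCommGroup E] [NormedSpace ℝ E] {H : Type*} [TopologicalSpace H]
  {I : ModelWithCorners ℝ E H} {M : Type*} [MetricSpace M] [ChartedSpace H M] [IsManifold I 1 M]
  [Bundle.RiemannianBundle (fun x : M ↦ TangentSpace I x)]
  [IsContinuousRiemannianBundle E (fun x : M ↦ TangentSpace I x)]

open Manifold

theorem eventually_nnnorm_continuousLinearMapAt_le (x : M) :
    ∃ C : ℝ≥0, ∀ᶠ y in 𝓝 x, ∀ w : TangentSpace I y,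
      ‖(trivializationAt E (TangentSpace I) x).continuousLinearMapAt ℝ y w‖₊ ≤ C * ‖w‖₊ := by
  obtain ⟨C, hC0, hC⟩ := eventually_norm_trivializationAt_lt E (fun x : M ↦ TangentSpace I x) x
  refine ⟨⟨C, hC0.le⟩, ?_⟩
  filter_upwards [hC] with y hy w
  exact (ContinuousLinearMap.le_opNorm _ w).trans (mul_le_mul_of_nonneg_right hy.le (norm_nonneg _))

variable [IsRiemannianManifold I M]

/-- The extended charts of a Riemannian manifold are locally Lipschitz. -/
theorem exists_lipschitzOnWith_extChartAt (x : M) :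
    ∃ K : ℝ≥0, ∃ U ∈ 𝓝 x, LipschitzOnWith K (extChartAt I x) U := by
  obtain ⟨C, hC⟩ := eventually_nnnorm_continuousLinearMapAt_le (I := I) x
  obtain ⟨ρ, hρ, hball⟩ := Metric.mem_nhds_iff.1 (inter_mem hC (chart_source_mem_nhds H x))
  refine ⟨C, ball x (ρ / 3), ball_mem_nhds x (by positivity), fun y hy z hz ↦ ?_⟩
  have hyz : edist y z < ENNReal.ofReal (2 * ρ / 3) := by
    rw [edist_lt_ofReal]
    have := dist_triangle_right y z x
    rw [mem_ball] at hy hz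
    linarith
  suffices hl : ∀ l, edist y z < l → l < ENNReal.ofReal (2 * ρ / 3) →
      edist (extChartAt I x y) (extChartAt I x z) ≤ C * l by
    have hlim : Tendsto (fun l ↦ (C : ℝ≥0∞) * l) (𝓝[>] edist y z) (𝓝 (C * edist y z)) :=
      (ENNReal.Tendsto.const_mul tendsto_id (Or.inr ENNReal.coe_ne_top)).mono_left
        nhdsWithin_le_nhds
    have : (𝓝[>] edist y z).NeBot := nhdsGT_neBot_of_exists_gt ⟨_, hyz⟩
    refine ge_of_tendsto hlim ?_
    filter_upwards [Ioo_mem_nhdsGT hyz] with l hl'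
    exact hl l hl'.1 hl'.2
  intro l hl hl'
  rw [IsRiemannianManifold.out (I := I) y z] at hl
  obtain ⟨γ, hγ0, hγ1, hγ, hlen, -⟩ :=
    exists_lt_locally_constant_of_riemannianEDist_lt hl zero_lt_one
  have hmem : ∀ t ∈ Icc (0 : ℝ) 1, γ t ∈ ball x ρ := by
    intro t ht
    have h1 : edist y (γ t) ≤ l := by
      rw [IsRiemannianManifold.out (I := I) y]
      exact (riemannianEDist_le_pathELength hγ.contMDiffOn hγ0 rfl ht.1).trans
        ((pathELength_mono le_rfl ht.2).trans hlen.le)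
    have h2 := h1.trans_lt hl'
    rw [edist_lt_ofReal] at h2
    rw [mem_ball] at hy ⊢
    have := dist_triangle_left (γ t) x y
    linarith
  have hder : ∀ t ∈ Icc (0 : ℝ) 1, HasDerivAt (fun s ↦ extChartAt I x (γ s))
      ((trivializationAt E (TangentSpace I) x).continuousLinearMapAt ℝ (γ t)
        (mfderiv 𝓘(ℝ, ℝ) I γ t (1 : ℝ))) t := fun t ht ↦
    ((hγ.mdifferentiable one_ne_zero t).hasMFDerivAt_smulRight).hasDerivAt_extChartAt_comp
      (hball (hmem t ht)).2
  have hsmooth : ContDiffOn ℝ 1 (fun s ↦ extChartAt I x (γ s)) (Icc 0 1) := by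
    rw [← contMDiffOn_iff_contDiffOn]
    exact contMDiffOn_extChartAt.comp (I' := I) (t := (chartAt H x).source) hγ.contMDiffOn
      fun t ht ↦ (hball (hmem t ht)).2
  calc edist (extChartAt I x y) (extChartAt I x z)
      = ‖extChartAt I x (γ 1) - extChartAt I x (γ 0)‖ₑ := by
        rw [hγ0, hγ1, edist_comm, edist_eq_enorm_sub]
    _ ≤ ∫⁻ t in Icc (0 : ℝ) 1, ‖derivWithin (fun s ↦ extChartAt I x (γ s)) (Icc 0 1) t‖ₑ :=
        enorm_sub_le_lintegral_derivWithin_Icc_of_contDiffOn_Icc hsmooth zero_le_one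
    _ ≤ ∫⁻ t in Icc (0 : ℝ) 1, C * ‖mfderiv 𝓘(ℝ, ℝ) I γ t (1 : ℝ)‖ₑ := by
        refine setLIntegral_mono' measurableSet_Icc fun t ht ↦ ?_
        rw [(hder t ht).hasDerivWithinAt.derivWithin (uniqueDiffOn_Icc zero_lt_one t ht)]
        exact ENNReal.coe_le_coe.2 ((hball (hmem t ht)).1 (mfderiv 𝓘(ℝ, ℝ) I γ t (1 : ℝ)))
    _ = C * pathELength I γ 0 1 := by
        rw [lintegral_const_mul' _ _ ENNReal.coe_ne_top, pathELength_eq_lintegral_mfderiv_Icc]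
        rfl
    _ ≤ C * l := by gcongr

end Riemannian

section Riemannian

variable {E : Type*} [NormedAddCommGroup E] [NormedSpace ℝ E] {H : Type*} [TopologicalSpace H]
  {I : ModelWithCorners ℝ E H} {M : Type*} [MetricSpace M] [ChartedSpace H M] [IsManifold I 1 M]
  [Bundle.RiemannianBundle (fun x : M ↦ TangentSpace I x)]
  [IsContinuousRiemannianBundle E (fun x : M ↦ TangentSpace I x)]

open Manifold

theorem eventually_norm_symmL_trivializationAt_le (x : M) :
    ∀ᶠ y in 𝓝 x, ∀ e : E, ‖(trivializationAt E (TangentSpace I) x).symmL ℝ y e‖ ≤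
      2 * ‖(trivializationAt E (TangentSpace I) x).symmL ℝ x e‖ := by
  filter_upwards [eventually_norm_symmL_trivializationAt_comp_self_lt E
    (fun x : M ↦ TangentSpace I x) x one_lt_two] with y hy e
  have h1 : (trivializationAt E (TangentSpace I) x).continuousLinearMapAt ℝ x
      ((trivializationAt E (TangentSpace I) x).symmL ℝ x e) = e :=
    Bundle.Trivialization.continuousLinearMapAt_symmL _ (FiberBundle.mem_baseSet_trivializationAt' x) e
  have h2 := ContinuousLinearMap.le_of_opNorm_le _ hy.le
    ((trivializationAt E (TangentSpace I) x).symmL ℝ x e)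
  rwa [ContinuousLinearMap.comp_apply, h1] at h2

omit [IsContinuousRiemannianBundle E (fun x : M ↦ TangentSpace I x)] in
theorem norm_mfderivWithin_extChartAt_symm {x : M} {z : E} (hz : z ∈ (extChartAt I x).target)
    (e : E) :
    ‖mfderivWithin 𝓘(ℝ, E) I (extChartAt I x).symm (range I) z e‖ =
      ‖(trivializationAt E (TangentSpace I) x).symmL ℝ ((extChartAt I x).symm z) e‖ := by
  have hy : (extChartAt I x).symm z ∈ (chartAt H x).source := by
    rw [← extChartAt_source I]; exact (extChartAt I x).map_target hz
  have h1 : ((trivializationAt E (TangentSpace I) x).symmL ℝ ((extChartAt I x).symm z) e : E) =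
      (mfderivWithin 𝓘(ℝ, E) I (extChartAt I x).symm (range I)
        (extChartAt I x ((extChartAt I x).symm z)) e : E) := by
    rw [TangentBundle.symmL_trivializationAt hy]; rfl
  have h2 : ∀ z', z' = z → (mfderivWithin 𝓘(ℝ, E) I (extChartAt I x).symm (range I) z' e : E) =
      (mfderivWithin 𝓘(ℝ, E) I (extChartAt I x).symm (range I) z e : E) := by
    rintro _ rfl; rfl
  rw [h2 _ ((extChartAt I x).right_inv hz)] at h1
  exact (congrArg (fun w : TangentSpace I ((extChartAt I x).symm z) ↦ ‖w‖) h1).symm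

variable [IsRiemannianManifold I M]

/-- Near `x`, the distance to `x` is at most twice the norm, in the tangent space at `x`, of the
difference in the extended chart. -/
theorem eventually_dist_le_norm_symmL (x : M) :
    ∀ᶠ y in 𝓝 x, dist x y ≤
      2 * ‖(trivializationAt E (TangentSpace I) x).symmL ℝ x
        (extChartAt I x y - extChartAt I x x)‖ := by
  obtain ⟨r, r_pos, hr⟩ : ∃ r > 0, ball (extChartAt I x x) r ∩ range I ⊆
      (extChartAt I x).target ∩ (extChartAt I x).symm ⁻¹' {y | ∀ e : E,
        ‖(trivializationAt E (TangentSpace I) x).symmL ℝ y e‖ ≤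
        2 * ‖(trivializationAt E (TangentSpace I) x).symmL ℝ x e‖} := by
    refine mem_nhdsWithin_iff.1 (inter_mem (extChartAt_target_mem_nhdsWithin x)
      (mem_nhdsWithin_of_mem_nhds ?_))
    exact extChartAt_preimage_mem_nhds (eventually_norm_symmL_trivializationAt_le (I := I) x)
  have A : (extChartAt I x) ⁻¹' (ball (extChartAt I x x) r ∩ range I) ∈ 𝓝 x := by
    apply extChartAt_preimage_mem_nhds_of_mem_nhdsWithin (by simp)
    rw [inter_comm]
    exact inter_mem_nhdsWithin _ (ball_mem_nhds _ r_pos)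
  filter_upwards [A, chart_source_mem_nhds H x] with y hy h'y
  set e : E := extChartAt I x y - extChartAt I x x with he
  let η : ℝ → E := fun t ↦ extChartAt I x x + t • e
  have hηd : ∀ t, HasDerivAt η e t := fun t ↦ by
    have := ((hasDerivAt_id t).smul_const e).const_add (extChartAt I x x)
    rwa [one_smul] at this
  have hη : Icc 0 1 ⊆ η ⁻¹' (ball (extChartAt I x x) r ∩ range I) := fun t ht ↦
    ((convex_ball _ _).inter I.convex_range).add_smul_sub_mem
      ⟨mem_ball_self r_pos, mem_range_self _⟩ hy ht
  have hηs : ContMDiffOn 𝓘(ℝ, ℝ) 𝓘(ℝ, E) 1 η (Icc 0 1) := by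
    rw [contMDiffOn_iff_contDiffOn]
    fun_prop
  let γ : ℝ → M := (extChartAt I x).symm ∘ η
  have hlen : riemannianEDist I x y ≤ pathELength I γ 0 1 := by
    apply riemannianEDist_le_pathELength _ _ _ zero_le_one
    · exact (contMDiffOn_extChartAt_symm x).comp hηs (hη.trans (preimage_mono fun z hz ↦ (hr hz).1))
    · simp [γ, η]
    · simp [γ, η, he, h'y]
  have hbound : pathELength I γ 0 1 ≤
      ENNReal.ofReal (2 * ‖(trivializationAt E (TangentSpace I) x).symmL ℝ x e‖) := by
    rw [pathELength_eq_lintegral_mfderivWithin_Icc]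
    refine (setLIntegral_mono' measurableSet_Icc (g := fun _ ↦
      ENNReal.ofReal (2 * ‖(trivializationAt E (TangentSpace I) x).symmL ℝ x e‖))
      fun t ht ↦ ?_).trans (by simp)
    have hz := hr (hη ht)
    have h1 := (mdifferentiableWithinAt_extChartAt_symm hz.1).hasMFDerivWithinAt.comp t
      (hηd t).hasFDerivAt.hasMFDerivAt.hasMFDerivWithinAt (s := Icc 0 1)
      (fun s hs ↦ (hη hs).2)
    have h2 : mfderivWithin 𝓘(ℝ, ℝ) I γ (Icc 0 1) t (1 : ℝ) =
        mfderivWithin 𝓘(ℝ, E) I (extChartAt I x).symm (range I) (η t) e := by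
      rw [h1.mfderivWithin (uniqueMDiffWithinAt_iff_uniqueDiffWithinAt.2
        (uniqueDiffOn_Icc zero_lt_one t ht))]
      exact congrArg (mfderivWithin 𝓘(ℝ, E) I (extChartAt I x).symm (range I) (η t))
        (by simp : ContinuousLinearMap.toSpanSingleton ℝ e (1 : ℝ) = e)
    refine (congrArg (fun w : TangentSpace I (γ t) ↦ ‖w‖ₑ) h2).trans_le ?_
    rw [← ofReal_norm]
    refine ENNReal.ofReal_le_ofReal ?_
    exact (norm_mfderivWithin_extChartAt_symm hz.1 e).trans_le (hz.2 e)
  have := hlen.trans hbound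
  rw [← IsRiemannianManifold.out (I := I) x y, edist_le_ofReal (by positivity)] at this
  exact this

/-- A curve on a Riemannian manifold moves with speed at most the norm of its derivative, up to a
universal factor. -/
theorem HasMFDerivAt.eventually_dist_le {γ : ℝ → M} {t : ℝ} {v : TangentSpace I (γ t)}
    (h : HasMFDerivAt 𝓘(ℝ, ℝ) I γ t ((1 : ℝ →L[ℝ] ℝ).smulRight v)) {C : ℝ} (hC : ‖v‖ ≤ C) :
    ∀ᶠ s in 𝓝 t, dist (γ s) (γ t) ≤ 2 * (C + 1) * |s - t| := by
  have h1 := h.hasDerivAt_extChartAt_comp (mem_chart_source H (γ t))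
  rw [trivializationAt_continuousLinearMapAt_self] at h1
  have h2 := ((trivializationAt E (TangentSpace I) (γ t)).symmL ℝ (γ t)).hasFDerivAt.comp_hasDerivAt
    t h1
  have h3 : (trivializationAt E (TangentSpace I) (γ t)).symmL ℝ (γ t) v = v := by
    conv_lhs => rw [← trivializationAt_continuousLinearMapAt_self (γ t) v]
    exact Bundle.Trivialization.symmL_continuousLinearMapAt _
      (FiberBundle.mem_baseSet_trivializationAt' (γ t)) v
  rw [hasDerivAt_iff_isLittleO] at h2
  filter_upwards [h2.bound one_pos, h.continuousAt.eventually
    (eventually_dist_le_norm_symmL (I := I) (γ t))] with s hs hd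
  rw [dist_comm]
  refine hd.trans ?_
  rw [mul_assoc]
  refine mul_le_mul_of_nonneg_left ?_ zero_le_two
  rw [map_sub]
  have h4 := (norm_le_norm_sub_add _
    ((s - t) • (trivializationAt E (TangentSpace I) (γ t)).symmL ℝ (γ t) v)).trans
    (add_le_add_left hs _)
  refine h4.trans ?_
  rw [norm_smul, one_mul, h3, Real.norm_eq_abs, add_mul, one_mul, add_comm, mul_comm]
  gcongr

end Riemannian

theorem Set.OrdConnected.ae_mem_interior {J : Set ℝ} (hJ : J.OrdConnected) :
    ∀ᵐ t : ℝ, t ∈ J → t ∈ interior J := by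
  have h := hJ.convex.addHaar_frontier volume
  filter_upwards [measure_eq_zero_iff_ae_notMem.1 h] with t ht htJ
  by_contra hint
  exact ht ⟨subset_closure htJ, hint⟩

theorem MeasureTheory.ae_of_locally {P : ℝ → Prop} {U : Set ℝ}
    (h : ∀ t ∈ U, ∃ V ∈ 𝓝 t, ∀ᵐ s, s ∈ V → P s) : ∀ᵐ t, t ∈ U → P t := by
  rw [ae_iff]
  refine measure_null_of_locally_null _ fun t ht ↦ ?_
  simp only [Classical.not_imp, mem_ofPred_eq] at ht
  obtain ⟨V, hV, hP⟩ := h t ht.1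
  refine ⟨_, inter_mem_nhdsWithin _ hV, measure_mono_null ?_ (ae_iff.1 hP)⟩
  rintro s ⟨hs, hsV⟩
  simp only [Classical.not_imp, mem_ofPred_eq] at hs ⊢
  exact ⟨hsV, hs.2⟩

namespace FilippovSystem

section Manifold

variable {E : Type*} [NormedAddCommGroup E] [NormedSpace ℝ E] {H : Type*} [TopologicalSpace H]
  {I : ModelWithCorners ℝ E H} {M : Type*} [MetricSpace M] [ChartedSpace H M] [IsManifold I 1 M]
  {r : ℕ∞} {Z : FilippovSystem I M r} {γ γ' : ℝ → M} {J : Set ℝ} {t : ℝ}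

/-- The curve `γ` is differentiable at `t`, with derivative in the multivalued field. -/
def SolvesAt (Z : FilippovSystem I M r) (γ : ℝ → M) (t : ℝ) : Prop :=
  ∃ v ∈ Z.field (γ t), HasMFDerivAt 𝓘(ℝ, ℝ) I γ t ((1 : ℝ →L[ℝ] ℝ).smulRight v)

theorem SolvesAt.congr (h : Z.SolvesAt γ t) (hγ : γ' =ᶠ[𝓝 t] γ) : Z.SolvesAt γ' t := by
  obtain ⟨v, hv, hd⟩ := h
  have key : ∀ p q : M, p = q → ∀ w : E, w ∈ (Z.field p : Set E) → w ∈ (Z.field q : Set E) := by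
    rintro p _ rfl w hw; exact hw
  exact ⟨v, key _ _ hγ.eq_of_nhds.symm v hv, hd.congr_of_eventuallyEq hγ⟩

theorem isSolutionOn_iff_solvesAt (hJ : J.OrdConnected) :
    Z.IsSolutionOn γ J ↔ LocallyLipschitzOn J γ ∧ ∀ᵐ t, t ∈ interior J → Z.SolvesAt γ t := by
  refine and_congr_right fun _ ↦ ⟨fun h ↦ ?_, fun h ↦ ?_⟩
  · filter_upwards [h] with t ht htJ
    obtain ⟨v, hv, hd⟩ := ht (interior_subset htJ)
    exact ⟨v, hv, hd.hasMFDerivAt (mem_interior_iff_mem_nhds.1 htJ)⟩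
  · filter_upwards [h, hJ.ae_mem_interior] with t ht hti htJ
    obtain ⟨v, hv, hd⟩ := ht (hti htJ)
    exact ⟨v, hv, hd.hasMFDerivWithinAt⟩

theorem convex_multiSign (x : ℝ) : Convex ℝ (multiSign x) := by
  unfold multiSign
  split_ifs
  exacts [convex_singleton _, convex_singleton _, convex_Icc _ _]

theorem isCompact_multiSign (x : ℝ) : IsCompact (multiSign x) := by
  unfold multiSign
  split_ifs
  exacts [isCompact_singleton, isCompact_singleton, isCompact_Icc]

theorem multiSign_subset_Icc (x : ℝ) : multiSign x ⊆ Icc (-1) 1 := by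
  unfold multiSign
  split_ifs <;> simp

theorem eventually_multiSign_subset {X : Type*} [TopologicalSpace X] {f : X → ℝ} {x : X}
    (hf : ContinuousAt f x) : ∀ᶠ y in 𝓝 x, multiSign (f y) ⊆ multiSign (f x) := by
  rcases lt_trichotomy (f x) 0 with h | h | h
  · filter_upwards [hf.eventually_lt_const h] with y hy
    simp [multiSign, h, hy, h.not_gt, hy.not_gt]
  · refine .of_forall fun y ↦ (multiSign_subset_Icc _).trans ?_
    simp [multiSign, h]
  · filter_upwards [hf.eventually_const_lt h] with y hy
    simp [multiSign, h, hy]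

theorem convex_field (p : M) : Convex ℝ (Z.field p) := by
  have h : Z.field p = (fun s : ℝ ↦ (1 / 2 : ℝ) • (Z.Zplus p + Z.Zminus p) +
      (s / 2) • (Z.Zplus p - Z.Zminus p)) '' multiSign (Z.h p) := by
    ext v; simp [field, eq_comm]
  intro v hv w hw a b ha hb hab
  obtain ⟨s, hs, rfl⟩ := hv
  obtain ⟨s', hs', rfl⟩ := hw
  refine ⟨a * s + b * s', convex_multiSign _ hs hs' ha hb hab, ?_⟩
  obtain rfl : b = 1 - a := by linarith
  module

theorem isCompact_field (p : M) : IsCompact (Z.field p) := by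
  have h : Z.field p = (fun s : ℝ ↦ (1 / 2 : ℝ) • (Z.Zplus p + Z.Zminus p) +
      (s / 2) • (Z.Zplus p - Z.Zminus p)) '' multiSign (Z.h p) := by
    ext v; simp [field, eq_comm]
  rw [h]
  exact (isCompact_multiSign _).image (by fun_prop)

end Manifold

end FilippovSystem

theorem lipschitzOnWith_of_tendsto {X Y ι : Type*} [PseudoMetricSpace X] [PseudoMetricSpace Y]
    {l : Filter ι} [l.NeBot] {c : ι → X → Y} {f : X → Y} {K : ℝ≥0} {s : Set X}
    (hc : ∀ᶠ n in l, LipschitzOnWith K (c n) s)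
    (hlim : ∀ x ∈ s, Tendsto (fun n ↦ c n x) l (𝓝 (f x))) : LipschitzOnWith K f s := by
  refine LipschitzOnWith.of_dist_le_mul fun x hx y hy ↦ ?_
  refine le_of_tendsto ((hlim x hx).dist (hlim y hy)) ?_
  filter_upwards [hc] with n hn using hn.dist_le_mul x hx y hy

section Riemannian

variable {E : Type*} [NormedAddCommGroup E] [NormedSpace ℝ E] {H : Type*} [TopologicalSpace H]
  {I : ModelWithCorners ℝ E H} {M : Type*} [MetricSpace M] [ChartedSpace H M] [IsManifold I 1 M]
  [Bundle.RiemannianBundle (fun x : M ↦ TangentSpace I x)]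
  [IsContinuousRiemannianBundle E (fun x : M ↦ TangentSpace I x)]
  [IsRiemannianManifold I M]

variable (I) in
/-- Rademacher's theorem for Lipschitz curves on a Riemannian manifold. -/
theorem LipschitzOnWith.ae_mdifferentiableAt [FiniteDimensional ℝ E] {γ : ℝ → M} {K : ℝ≥0}
    {U : Set ℝ} (hU : IsOpen U) (hγ : LipschitzOnWith K γ U) :
    ∀ᵐ t, t ∈ U → MDifferentiableAt 𝓘(ℝ, ℝ) I γ t := by
  refine ae_of_locally fun t ht ↦ ?_
  obtain ⟨C, W, hW, hC⟩ := exists_lipschitzOnWith_extChartAt (I := I) (γ t)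
  have hcont : ContinuousAt γ t := hγ.continuousOn.continuousAt (hU.mem_nhds ht)
  obtain ⟨V, hV, hVo, htV⟩ := _root_.mem_nhds_iff.1 (inter_mem (hU.mem_nhds ht)
    (hcont (inter_mem hW (chart_source_mem_nhds H (γ t)))))
  have hlip : LipschitzOnWith (C * K) (extChartAt I (γ t) ∘ γ) V :=
    hC.comp (hγ.mono fun s hs ↦ (hV hs).1) fun s hs ↦ (hV hs).2.1
  refine ⟨V, hVo.mem_nhds htV, ?_⟩
  have h := hlip.ae_differentiableWithinAt_real hVo.measurableSet
  rw [ae_restrict_iff' hVo.measurableSet] at h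
  filter_upwards [h] with s hs hsV
  have h1 : MDifferentiableAt 𝓘(ℝ, ℝ) 𝓘(ℝ, E) (extChartAt I (γ t) ∘ γ) s :=
    ((hs hsV).differentiableAt (hVo.mem_nhds hsV)).mdifferentiableAt
  have hsrc : ∀ u ∈ V, γ u ∈ (extChartAt I (γ t)).source := fun u hu ↦ by
    rw [extChartAt_source]; exact (hV hu).2.2
  have h2 := mdifferentiableWithinAt_extChartAt_symm ((extChartAt I (γ t)).map_source (hsrc s hsV))
  have h3 := h2.comp (u := range I) s h1.mdifferentiableWithinAt (s := V) fun w hu ↦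
    extChartAt_target_subset_range (γ t) ((extChartAt I (γ t)).map_source (hsrc w hu))
  refine (h3.mdifferentiableAt (hVo.mem_nhds hsV)).congr_of_eventuallyEq ?_
  filter_upwards [hVo.mem_nhds hsV] with u hu
  exact ((extChartAt I (γ t)).left_inv (hsrc u hu)).symm

namespace FilippovSystem

variable {r : ℕ∞} {Z : FilippovSystem I M r} {γ : ℝ → M} {J : Set ℝ} {C : ℝ≥0}

theorem lipschitzOnWith_of_ae_solvesAt (hC : ∀ p, ∀ v ∈ Z.field p, ‖v‖ ≤ C) (hJ : J.OrdConnected)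
    (hγ : LocallyLipschitzOn J γ) (h : ∀ᵐ t, t ∈ interior J → Z.SolvesAt γ t) :
    LipschitzOnWith (2 * (C + 1)) γ J := by
  suffices key : ∀ a ∈ J, ∀ b ∈ J, a ≤ b → dist (γ a) (γ b) ≤ 2 * (C + 1) * (b - a) by
    refine LipschitzOnWith.of_dist_le_mul fun a ha b hb ↦ ?_
    push_cast
    rcases le_total a b with hab | hab
    · rw [dist_comm a, Real.dist_eq, abs_of_nonneg (sub_nonneg.2 hab)]
      exact key a ha b hb hab
    · rw [dist_comm, Real.dist_eq, abs_of_nonneg (sub_nonneg.2 hab)]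
      exact key b hb a ha hab
  intro a ha b hb hab
  obtain ⟨K, hK⟩ := (hγ.mono (hJ.out ha hb)).exists_lipschitzOnWith_of_compact isCompact_Icc
  refine hK.dist_le_of_ae_speed_le (by positivity) hab ?_
  filter_upwards [h] with t ht hmem
  obtain ⟨v, hv, hd⟩ := ht (interior_mono (hJ.out ha hb) (by rwa [interior_Icc]))
  exact hd.eventually_dist_le (hC _ v hv)

theorem isSolutionOn_iff (hC : ∀ p, ∀ v ∈ Z.field p, ‖v‖ ≤ C) (hJ : J.OrdConnected) :
    Z.IsSolutionOn γ J ↔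
      LipschitzOnWith (2 * (C + 1)) γ J ∧ ∀ᵐ t, t ∈ interior J → Z.SolvesAt γ t := by
  rw [isSolutionOn_iff_solvesAt hJ]
  exact ⟨fun h ↦ ⟨lipschitzOnWith_of_ae_solvesAt hC hJ h.1 h.2, h.2⟩,
    fun h ↦ ⟨fun _ _ ↦ ⟨_, J, self_mem_nhdsWithin, h.1⟩, h.2⟩⟩

omit [Bundle.RiemannianBundle (fun x : M ↦ TangentSpace I x)]
  [IsContinuousRiemannianBundle E (fun x : M ↦ TangentSpace I x)]
  [IsRiemannianManifold I M] in
theorem continuousAt_continuousLinearMapAt {X : (p : M) → TangentSpace I p} {p : M}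
    (hX : ContinuousAt (fun p ↦ (⟨p, X p⟩ : TangentBundle I M)) p) :
    ContinuousAt (fun y ↦ (trivializationAt E (TangentSpace I) p).continuousLinearMapAt ℝ y (X y))
      p := by
  rw [FiberBundle.continuousAt_totalSpace] at hX
  refine hX.2.congr ?_
  filter_upwards [(trivializationAt E (TangentSpace I) p).open_baseSet.mem_nhds
    (FiberBundle.mem_baseSet_trivializationAt' p)] with y hy
  rw [Bundle.Trivialization.continuousLinearMapAt_apply,
    Bundle.Trivialization.coe_linearMapAt_of_mem _ hy]

omit [Bundle.RiemannianBundle (fun x : M ↦ TangentSpace I x)]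
  [IsContinuousRiemannianBundle E (fun x : M ↦ TangentSpace I x)]
  [IsRiemannianManifold I M] in
/-- Upper semicontinuity of the multivalued field, read in a chart and tested on a linear form. -/
theorem eventually_forall_field_lt (p : M) {L : E →L[ℝ] ℝ} {a : ℝ}
    (h : ∀ v ∈ Z.field p, L v < a) :
    ∀ᶠ y in 𝓝 p, ∀ v ∈ Z.field y,
      L ((trivializationAt E (TangentSpace I) p).continuousLinearMapAt ℝ y v) < a := by
  let A : (y : M) → TangentSpace I y →L[ℝ] E := fun y ↦
    (trivializationAt E (TangentSpace I) p).continuousLinearMapAt ℝ y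
  have hself : ∀ v : TangentSpace I p, A p v = v := trivializationAt_continuousLinearMapAt_self p
  have hP : ContinuousAt (fun y ↦ L (A y (Z.Zplus y))) p :=
    L.continuous.continuousAt.comp
      (continuousAt_continuousLinearMapAt Z.contMDiff_Zplus.continuous.continuousAt)
  have hN : ContinuousAt (fun y ↦ L (A y (Z.Zminus y))) p :=
    L.continuous.continuousAt.comp
      (continuousAt_continuousLinearMapAt Z.contMDiff_Zminus.continuous.continuousAt)
  have hA : ∀ (y : M) (s : ℝ), L (A y ((1 / 2 : ℝ) • (Z.Zplus y + Z.Zminus y) +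
      (s / 2) • (Z.Zplus y - Z.Zminus y))) = (1 / 2 : ℝ) * (L (A y (Z.Zplus y)) +
      L (A y (Z.Zminus y))) + (s / 2) * (L (A y (Z.Zplus y)) - L (A y (Z.Zminus y))) := by
    intro y s
    simp only [map_add, map_sub, map_smul, smul_eq_mul]
  have hall : ∀ᶠ y in 𝓝 p, ∀ s ∈ multiSign (Z.h p), (1 / 2 : ℝ) * (L (A y (Z.Zplus y)) +
      L (A y (Z.Zminus y))) + (s / 2) * (L (A y (Z.Zplus y)) - L (A y (Z.Zminus y))) < a := by
    refine (isCompact_multiSign (Z.h p)).eventually_forall_of_forall_eventually fun s hs ↦ ?_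
    have hP' : ContinuousAt (fun z : M × ℝ ↦ L (A z.1 (Z.Zplus z.1))) (p, s) :=
      ContinuousAt.comp (f := Prod.fst) (x := (p, s)) hP continuousAt_fst
    have hN' : ContinuousAt (fun z : M × ℝ ↦ L (A z.1 (Z.Zminus z.1))) (p, s) :=
      ContinuousAt.comp (f := Prod.fst) (x := (p, s)) hN continuousAt_fst
    refine ContinuousAt.eventually_lt (f := fun z : M × ℝ ↦ (1 / 2 : ℝ) * (L (A z.1 (Z.Zplus z.1)) +
      L (A z.1 (Z.Zminus z.1))) + (z.2 / 2) * (L (A z.1 (Z.Zplus z.1)) -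
      L (A z.1 (Z.Zminus z.1)))) ((continuousAt_const.mul (hP'.add hN')).add
      ((continuousAt_snd.div_const 2).mul (hP'.sub hN'))) continuousAt_const ?_
    rw [← hA, hself]
    exact h _ ⟨s, hs, rfl⟩
  filter_upwards [hall, eventually_multiSign_subset Z.contMDiff_h.continuous.continuousAt]
    with y hy hsub
  rintro _ ⟨s, hs, rfl⟩
  exact (hA y s).trans_lt (hy s (hsub hs))

/-- Limits of Lipschitz solutions are solutions wherever they are differentiable. -/
theorem solvesAt_of_tendsto {ι : Type*} {l : Filter ι} [l.NeBot] {c : ι → ℝ → M} {K : ℝ≥0}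
    {a b : ℝ} (hc : ∀ᶠ n in l, LipschitzOnWith K (c n) (Icc a b))
    (hsol : ∀ᶠ n in l, ∀ᵐ t, t ∈ Ioo a b → Z.SolvesAt (c n) t)
    (hlim : ∀ t ∈ Icc a b, Tendsto (fun n ↦ c n t) l (𝓝 (γ t))) {t : ℝ} (ht : t ∈ Ioo a b)
    (hd : MDifferentiableAt 𝓘(ℝ, ℝ) I γ t) : Z.SolvesAt γ t := by
  refine ⟨_, ?_, hd.hasMFDerivAt_smulRight⟩
  set v : TangentSpace I (γ t) := mfderiv 𝓘(ℝ, ℝ) I γ t (1 : ℝ) with hv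
  by_contra hmem
  obtain ⟨L', u, hL, hu⟩ := geometric_hahn_banach_closed_point (convex_field (Z := Z) (γ t))
    (isCompact_field (γ t)).isClosed hmem
  let L : E →L[ℝ] ℝ := L'
  obtain ⟨D, W, hW, hD⟩ := exists_lipschitzOnWith_extChartAt (I := I) (γ t)
  obtain ⟨ρ, hρ, hball⟩ := Metric.mem_nhds_iff.1 (inter_mem (inter_mem hW
    (chart_source_mem_nhds H (γ t))) (eventually_forall_field_lt (Z := Z) (γ t) (L := L) hL))
  let g : M → ℝ := fun x ↦ L (extChartAt I (γ t) x)
  have hder : HasDerivAt (fun s ↦ g (γ s)) (L v) t := by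
    have h1 := hd.hasMFDerivAt_smulRight.hasDerivAt_extChartAt_comp (mem_chart_source H (γ t))
    rw [trivializationAt_continuousLinearMapAt_self] at h1
    exact L.hasFDerivAt.comp_hasDerivAt t h1
  refine absurd hu (not_lt.2 ?_)
  have hδ : ∃ δ > 0, K * δ < ρ / 2 := ⟨ρ / (4 * (K + 1)), by positivity, by
    rw [mul_div_assoc', div_lt_div_iff₀ (by positivity) (by positivity)]
    nlinarith [K.2]⟩
  obtain ⟨δ, hδ0, hδ⟩ := hδ
  have hineq : ∀ᶠ s in 𝓝[>] t, (g (γ s) - g (γ t)) ≤ u * (s - t) := by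
    filter_upwards [Ioo_mem_nhdsGT (show t < min b (t + δ) from lt_min ht.2 (by linarith))]
      with s hs
    have hsb : s < b := hs.2.trans_le (min_le_left _ _)
    have hsδ : s < t + δ := hs.2.trans_le (min_le_right _ _)
    have hsub : Icc t s ⊆ Icc a b := Icc_subset_Icc ht.1.le hsb.le
    have hnear : ∀ᶠ n in l, ∀ τ ∈ Icc t s, c n τ ∈ ball (γ t) ρ := by
      filter_upwards [hc, (hlim t ⟨ht.1.le, ht.2.le⟩).eventually (ball_mem_nhds _ (half_pos hρ))]
        with n hn hn' τ hτ
      have h1 := hn.dist_le_mul τ (hsub hτ) t ⟨ht.1.le, ht.2.le⟩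
      have h2 : (K : ℝ) * dist τ t ≤ K * δ := by
        gcongr
        rw [Real.dist_eq, abs_of_nonneg (sub_nonneg.2 hτ.1)]
        linarith [hτ.2]
      rw [mem_ball]
      linarith [dist_triangle (c n τ) (c n t) (γ t)]
    have hbound : ∀ᶠ n in l, g (c n s) - g (c n t) ≤ u * (s - t) := by
      filter_upwards [hc, hsol, hnear] with n hn hn' hnb
      have hlip : LipschitzOnWith (‖L‖₊ * (D * K)) (fun τ ↦ g (c n τ)) (Icc t s) :=
        L.lipschitz.comp_lipschitzOnWith
          (hD.comp (hn.mono hsub) fun τ hτ ↦ (hball (hnb τ hτ)).1.1)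
      refine hlip.sub_le_mul_of_ae_deriv_le hs.1.le ?_
      filter_upwards [hn'] with τ hτ hmem
      obtain ⟨w, hw, hdw⟩ := hτ ⟨ht.1.trans hmem.1, hmem.2.trans hsb⟩
      have hτb := hball (hnb τ (Ioo_subset_Icc_self hmem))
      have h3 := L.hasFDerivAt.comp_hasDerivAt τ (hdw.hasDerivAt_extChartAt_comp hτb.1.2)
      exact (h3.deriv.trans_lt (hτb.2 w hw)).le
    have hg : ∀ y ∈ ball (γ t) ρ, ContinuousAt g y := fun y hy ↦
      L.continuous.continuousAt.comp (continuousAt_extChartAt' (by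
        rw [extChartAt_source]; exact (hball hy).1.2))
    have hγs : γ s ∈ ball (γ t) ρ := by
      have h1 := (lipschitzOnWith_of_tendsto hc hlim).dist_le_mul s (hsub ⟨hs.1.le, le_rfl⟩) t
        ⟨ht.1.le, ht.2.le⟩
      have h2 : (K : ℝ) * dist s t ≤ K * δ := by
        gcongr
        rw [Real.dist_eq, abs_of_nonneg (sub_nonneg.2 hs.1.le)]
        linarith
      rw [mem_ball]
      linarith
    exact le_of_tendsto (((hg _ hγs).tendsto.comp (hlim s (hsub ⟨hs.1.le, le_rfl⟩))).sub
      ((hg _ (mem_ball_self hρ)).tendsto.comp (hlim t ⟨ht.1.le, ht.2.le⟩))) hbound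
  have hslope := (hasDerivWithinAt_iff_tendsto_slope' self_notMem_Ioi).1
    (hder.hasDerivWithinAt (s := Ioi t))
  refine le_of_tendsto hslope ?_
  filter_upwards [hineq, self_mem_nhdsWithin] with s hs hst
  rw [slope_def_field, div_le_iff₀ (sub_pos.2 hst)]
  exact hs

theorem isSolutionOn_of_tendsto [FiniteDimensional ℝ E] (hC : ∀ p, ∀ v ∈ Z.field p, ‖v‖ ≤ C)
    {ι : Type*} {l : Filter ι} [l.NeBot]
    {c : ι → ℝ → M} {a b : ℝ} (hc : ∀ᶠ n in l, Z.IsSolutionOn (c n) (Icc a b))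
    (hlim : ∀ t ∈ Icc a b, Tendsto (fun n ↦ c n t) l (𝓝 (γ t))) : Z.IsSolutionOn γ (Icc a b) := by
  have hc1 : ∀ᶠ n in l, LipschitzOnWith (2 * (C + 1)) (c n) (Icc a b) := by
    filter_upwards [hc] with n hn using ((isSolutionOn_iff hC ordConnected_Icc).1 hn).1
  have hc2 : ∀ᶠ n in l, ∀ᵐ t, t ∈ Ioo a b → Z.SolvesAt (c n) t := by
    filter_upwards [hc] with n hn
    simpa using ((isSolutionOn_iff hC ordConnected_Icc).1 hn).2
  have hγ := lipschitzOnWith_of_tendsto hc1 hlim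
  refine (isSolutionOn_iff hC ordConnected_Icc).2 ⟨hγ, ?_⟩
  rw [interior_Icc]
  filter_upwards [(hγ.mono Ioo_subset_Icc_self).ae_mdifferentiableAt I isOpen_Ioo] with t h1 ht
  exact solvesAt_of_tendsto hc1 hc2 hlim ht (h1 ht)

end FilippovSystem
end Riemannian

/-- The nearest point projection of `ℝ` on the closure of an interval `J`. -/
def intervalClamp (J : Set ℝ) (t : ℝ) : ℝ :=
  open Classical in
  if t ∈ upperBounds J then sSup J else if t ∈ lowerBounds J then sInf J else t

section intervalClamp

variable {J : Set ℝ} {s t : ℝ}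

theorem Set.OrdConnected.mem_of_notMem_bounds (hJ : J.OrdConnected) (h1 : t ∉ upperBounds J)
    (h2 : t ∉ lowerBounds J) : t ∈ J := by
  simp only [upperBounds, lowerBounds, mem_ofPred_eq, not_forall, not_le] at h1 h2
  obtain ⟨a, ha, hta⟩ := h1
  obtain ⟨b, hb, htb⟩ := h2
  exact hJ.out hb ha ⟨htb.le, hta.le⟩

theorem intervalClamp_mem_closure (hJ : J.OrdConnected) (hne : J.Nonempty) (t : ℝ) :
    intervalClamp J t ∈ closure J := by
  unfold intervalClamp
  split_ifs with h1 h2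
  · exact csSup_mem_closure hne ⟨t, h1⟩
  · exact csInf_mem_closure hne ⟨t, h2⟩
  · exact subset_closure (hJ.mem_of_notMem_bounds h1 h2)

theorem intervalClamp_of_mem (ht : t ∈ J) : intervalClamp J t = t := by
  unfold intervalClamp
  split_ifs with h1 h2
  · exact IsGreatest.csSup_eq ⟨ht, h1⟩
  · exact IsLeast.csInf_eq ⟨ht, h2⟩
  · rfl

theorem intervalClamp_of_mem_upperBounds (ht : t ∈ upperBounds J) :
    intervalClamp J t = sSup J := by
  simp [intervalClamp, ht]

theorem Set.Nontrivial.notMem_upperBounds_of_mem_lowerBounds (hJ : J.Nontrivial)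
    (ht : t ∈ lowerBounds J) : t ∉ upperBounds J := fun h ↦ by
  obtain ⟨a, ha, b, hb, hab⟩ := hJ
  exact hab (((h ha).antisymm (ht ha)).trans ((h hb).antisymm (ht hb)).symm)

theorem intervalClamp_of_mem_lowerBounds (hJ : J.Nontrivial) (ht : t ∈ lowerBounds J) :
    intervalClamp J t = sInf J := by
  simp [intervalClamp, ht, hJ.notMem_upperBounds_of_mem_lowerBounds ht]

theorem lipschitzWith_intervalClamp (hJ : J.OrdConnected) (hne : J.Nonempty) :
    LipschitzWith 1 (intervalClamp J) := by
  have key : ∀ s t, s ≤ t → intervalClamp J s ≤ intervalClamp J t ∧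
      intervalClamp J t - intervalClamp J s ≤ t - s := by
    intro s t hst
    obtain ⟨j, hj⟩ := hne
    unfold intervalClamp
    split_ifs with h1 h2 h3 h4 h5 h6 h7 h8
    · simpa using hst
    · exact absurd (fun x hx ↦ (h1 hx).trans hst) h2
    · exact absurd (fun x hx ↦ (h1 hx).trans hst) h2
    · have h1' := csSup_le ⟨j, hj⟩ h5
      have h2' := le_csInf ⟨j, hj⟩ h4
      have h3' := csInf_le ⟨s, h4⟩ hj
      have h4' := le_csSup ⟨t, h5⟩ hj
      constructor <;> linarith
    · simpa using hst
    · have h := csInf_le ⟨s, h4⟩ (hJ.mem_of_notMem_bounds h5 h6)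
      have h' := le_csInf ⟨j, hj⟩ h4
      constructor <;> linarith
    · have h := le_csSup ⟨t, h7⟩ (hJ.mem_of_notMem_bounds h1 h4)
      have h' := csSup_le ⟨j, hj⟩ h7
      constructor <;> linarith
    · exact absurd (fun x hx ↦ hst.trans (h8 hx)) h4
    · simpa using hst
  refine LipschitzWith.of_dist_le_mul fun s t ↦ ?_
  rw [NNReal.coe_one, one_mul, Real.dist_eq, Real.dist_eq]
  rcases le_total s t with h | h
  · rw [abs_sub_comm, abs_sub_comm s, abs_of_nonneg, abs_of_nonneg] <;> linarith [key s t h]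
  · rw [abs_of_nonneg, abs_of_nonneg] <;> linarith [key t s h]

end intervalClamp

namespace FilippovSystem

section Manifold

variable {E : Type*} [NormedAddCommGroup E] [NormedSpace ℝ E] {H : Type*} [TopologicalSpace H]
  {I : ModelWithCorners ℝ E H} {M : Type*} [MetricSpace M] [ChartedSpace H M] [IsManifold I 1 M]
  {r : ℕ∞} {Z : FilippovSystem I M r} {γ γ' : ℝ → M} {J J' : Set ℝ} {a b t : ℝ} {p : M}

theorem IsSolutionOn.mono (h : Z.IsSolutionOn γ J) (hJ : J.OrdConnected) (hJ' : J'.OrdConnected)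
    (hsub : J' ⊆ J) : Z.IsSolutionOn γ J' := by
  rw [isSolutionOn_iff_solvesAt hJ] at h
  rw [isSolutionOn_iff_solvesAt hJ']
  refine ⟨h.1.mono hsub, ?_⟩
  filter_upwards [h.2] with t ht htJ using ht (interior_mono hsub htJ)

theorem IsSolutionOn.congr (h : Z.IsSolutionOn γ J) (hJ : J.OrdConnected) (heq : EqOn γ' γ J) :
    Z.IsSolutionOn γ' J := by
  rw [isSolutionOn_iff_solvesAt hJ] at h ⊢
  constructor
  · intro x hx
    obtain ⟨K, u, hu, hK⟩ := h.1 hx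
    refine ⟨K, u ∩ J, inter_mem hu self_mem_nhdsWithin, fun y hy z hz ↦ ?_⟩
    rw [heq hy.2, heq hz.2]
    exact hK hy.1 hz.1
  · filter_upwards [h.2] with t ht htJ
    exact (ht htJ).congr (heq.eventuallyEq_of_mem (mem_interior_iff_mem_nhds.1 htJ))

theorem solvesAt_const (hp : (0 : TangentSpace I p) ∈ Z.field p) (t : ℝ) :
    Z.SolvesAt (fun _ ↦ p) t := by
  refine ⟨0, hp, ?_⟩
  have h := hasMFDerivAt_const (I := 𝓘(ℝ, ℝ)) (I' := I) p t
  have key : (0 : ℝ →L[ℝ] E) = (1 : ℝ →L[ℝ] ℝ).smulRight (0 : E) := by ext; simp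
  exact h.congr_mfderiv key

theorem zero_mem_field (h : Z.IsSolutionOn γ J) (hJ : J.OrdConnected) (hab : a < b)
    (hsub : Icc a b ⊆ J) (hp : ∀ t ∈ Icc a b, γ t = p) : (0 : TangentSpace I p) ∈ Z.field p := by
  have h1 := (h.mono hJ ordConnected_Icc hsub).congr (γ' := fun _ ↦ p) ordConnected_Icc
    fun t ht ↦ (hp t ht).symm
  rw [isSolutionOn_iff_solvesAt ordConnected_Icc, interior_Icc] at h1
  have hex : ∃ t, Z.SolvesAt (fun _ ↦ p) t := by
    by_contra! hne
    have h2 : ∀ᵐ t : ℝ, t ∉ Ioo a b := by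
      filter_upwards [h1.2] with t ht htm using hne t (ht htm)
    have h3 := measure_eq_zero_iff_ae_notMem.2 h2
    rw [Real.volume_Ioo] at h3
    simp at h3
    linarith
  obtain ⟨t, v, hv, hd⟩ := hex
  have h2 := hasMFDerivAt_unique hd (hasMFDerivAt_const (I := 𝓘(ℝ, ℝ)) (I' := I) p t)
  have key : ∀ w : E, (1 : ℝ →L[ℝ] ℝ).smulRight w = 0 → w = 0 := fun w hw ↦ by
    simpa using congr($hw 1)
  have hv0 : v = 0 := key v h2
  rwa [hv0] at hv

end Manifold

section Riemannian

variable {E : Type*} [NormedAddCommGroup E] [NormedSpace ℝ E] {H : Type*} [TopologicalSpace H]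
  {I : ModelWithCorners ℝ E H} {M : Type*} [MetricSpace M] [ChartedSpace H M] [IsManifold I 1 M]
  [Bundle.RiemannianBundle (fun x : M ↦ TangentSpace I x)]
  [IsContinuousRiemannianBundle E (fun x : M ↦ TangentSpace I x)]
  [IsRiemannianManifold I M]
  {r : ℕ∞} {Z : FilippovSystem I M r} {γ γ' : ℝ → M} {J J' : Set ℝ} {a b t : ℝ} {p : M} {C : ℝ≥0}

theorem isSolutionOn_of_forall_Icc (hC : ∀ p, ∀ v ∈ Z.field p, ‖v‖ ≤ C) (hJ : J.OrdConnected)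
    (h : ∀ a ∈ J, ∀ b ∈ J, a ≤ b → Z.IsSolutionOn γ (Icc a b)) : Z.IsSolutionOn γ J := by
  refine (isSolutionOn_iff hC hJ).2 ⟨fun a ha b hb ↦ ?_, ae_of_locally fun t ht ↦ ?_⟩
  · rcases le_total a b with hab | hab
    · exact ((isSolutionOn_iff hC ordConnected_Icc).1 (h a ha b hb hab)).1
        ⟨le_rfl, hab⟩ ⟨hab, le_rfl⟩
    · exact ((isSolutionOn_iff hC ordConnected_Icc).1 (h b hb a ha hab)).1
        ⟨hab, le_rfl⟩ ⟨le_rfl, hab⟩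
  · obtain ⟨a, b, htab, hnhds, hsub⟩ :=
      exists_Icc_mem_subset_of_mem_nhds (mem_interior_iff_mem_nhds.1 ht)
    have hab := htab.1.trans htab.2
    exact ⟨_, interior_mem_nhds.2 hnhds, ((isSolutionOn_iff hC ordConnected_Icc).1
      (h a (hsub ⟨le_rfl, hab⟩) b (hsub ⟨hab, le_rfl⟩) hab)).2⟩

namespace Orbit

omit [Bundle.RiemannianBundle (fun x : M ↦ TangentSpace I x)]
  [IsContinuousRiemannianBundle E (fun x : M ↦ TangentSpace I x)]
  [IsRiemannianManifold I M] in
theorem curve_intervalClamp (γ : Z.Orbit) (t : ℝ) :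
    γ.curve (intervalClamp γ.domain t) = γ.curve t := by
  have hne := γ.isMaximal.nontrivial.nonempty
  unfold intervalClamp
  split_ifs with h1 h2
  · exact γ.stationary_after _ (isLUB_csSup hne ⟨t, h1⟩).1 _ h1
  · exact γ.stationary_before _ (isGLB_csInf hne ⟨t, h2⟩).1 _ h2
  · rfl

theorem lipschitzWith_curve (hC : ∀ p, ∀ v ∈ Z.field p, ‖v‖ ≤ C) (γ : Z.Orbit) :
    LipschitzWith (2 * (C + 1)) γ.curve := by
  have h1 := ((isSolutionOn_iff hC γ.isMaximal.ordConnected).1 γ.isMaximal.isSolutionOn).1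
  have h2 : LipschitzOnWith (2 * (C + 1)) γ.curve (closure γ.domain) :=
    h1.closure γ.continuous_curve.continuousOn
  have h3 : γ.curve = γ.curve ∘ intervalClamp γ.domain :=
    funext fun t ↦ (γ.curve_intervalClamp t).symm
  rw [h3, ← lipschitzOnWith_univ]
  have h4 := h2.comp (lipschitzWith_intervalClamp γ.isMaximal.ordConnected
    γ.isMaximal.nontrivial.nonempty).lipschitzOnWith (s := univ) fun t _ ↦
      intervalClamp_mem_closure γ.isMaximal.ordConnected γ.isMaximal.nontrivial.nonempty t
  rwa [mul_one] at h4

/-- An orbit does not extend, as a solution, to a larger interval on which its stationary extension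
stands at a zero of the field. -/
theorem eq_domain_of_zero_mem_field (hC : ∀ p, ∀ v ∈ Z.field p, ‖v‖ ≤ C) (γ : Z.Orbit)
    {J' U : Set ℝ} (hJ' : J'.OrdConnected) (hsub : γ.domain ⊆ J') (hU : IsOpen U)
    (hcov : ∀ᵐ t, t ∈ J' → t ∈ γ.domain ∨ t ∈ U) (hconst : ∀ t ∈ U, γ.curve t = p)
    (hp : (0 : TangentSpace I p) ∈ Z.field p) : J' ⊆ γ.domain := by
  refine γ.isMaximal.maximal γ.curve J' hJ' hsub ?_ fun _ _ ↦ rfl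
  refine (isSolutionOn_iff hC hJ').2 ⟨(γ.lipschitzWith_curve hC).lipschitzOnWith, ?_⟩
  filter_upwards [((isSolutionOn_iff hC γ.isMaximal.ordConnected).1 γ.isMaximal.isSolutionOn).2,
    γ.isMaximal.ordConnected.ae_mem_interior, hcov] with t h1 h2 h3 ht
  rcases h3 (interior_subset ht) with h | h
  · exact h1 (h2 h)
  · exact (solvesAt_const hp t).congr (eventually_of_mem (hU.mem_nhds h) hconst)

/-- Where an orbit stops, the field does not vanish. -/
theorem zero_notMem_field_of_mem_upperBounds (hC : ∀ p, ∀ v ∈ Z.field p, ‖v‖ ≤ C) (γ : Z.Orbit)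
    (hb : b ∈ upperBounds γ.domain) : (0 : TangentSpace I (γ.curve b)) ∉ Z.field (γ.curve b) := by
  intro h0
  have hne := γ.isMaximal.nontrivial.nonempty
  have hlub := isLUB_csSup hne ⟨b, hb⟩
  have key := γ.eq_domain_of_zero_mem_field hC (J' := (upperClosure γ.domain : Set ℝ))
    (U := Ioi (sSup γ.domain)) (upperClosure γ.domain).upper.ordConnected subset_upperClosure
    isOpen_Ioi ?_ (fun t ht ↦ γ.stationary_after t
      (fun x hx ↦ (hlub.1 hx).trans (le_of_lt ht)) b hb) h0
  · obtain ⟨a, ha⟩ := hne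
    have h1 : b + 1 ∈ γ.domain := key ⟨a, ha, (hb ha).trans (by linarith)⟩
    linarith [hb h1]
  · filter_upwards [measure_eq_zero_iff_ae_notMem.1 (Real.volume_singleton (a := sSup γ.domain))]
      with t ht htJ
    obtain ⟨a, ha, hat⟩ := htJ
    rcases le_or_gt t (sSup γ.domain) with h | h
    · obtain ⟨c, hc, htc⟩ := exists_lt_of_lt_csSup hne (lt_of_le_of_ne h ht)
      exact Or.inl (γ.isMaximal.ordConnected.out ha hc ⟨hat, htc.le⟩)
    · exact Or.inr h

/-- Where an orbit starts, the field does not vanish. -/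
theorem zero_notMem_field_of_mem_lowerBounds (hC : ∀ p, ∀ v ∈ Z.field p, ‖v‖ ≤ C) (γ : Z.Orbit)
    (hb : b ∈ lowerBounds γ.domain) : (0 : TangentSpace I (γ.curve b)) ∉ Z.field (γ.curve b) := by
  intro h0
  have hne := γ.isMaximal.nontrivial.nonempty
  have hglb := isGLB_csInf hne ⟨b, hb⟩
  have key := γ.eq_domain_of_zero_mem_field hC (J' := (lowerClosure γ.domain : Set ℝ))
    (U := Iio (sInf γ.domain)) (lowerClosure γ.domain).lower.ordConnected subset_lowerClosure
    isOpen_Iio ?_ (fun t ht ↦ γ.stationary_before t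
      (fun x hx ↦ (le_of_lt ht).trans (hglb.1 hx)) b hb) h0
  · obtain ⟨a, ha⟩ := hne
    have h1 : b - 1 ∈ γ.domain := key ⟨a, ha, (by linarith : b - 1 ≤ b).trans (hb ha)⟩
    linarith [hb h1]
  · filter_upwards [measure_eq_zero_iff_ae_notMem.1 (Real.volume_singleton (a := sInf γ.domain))]
      with t ht htJ
    obtain ⟨a, ha, hat⟩ := htJ
    rcases le_or_gt (sInf γ.domain) t with h | h
    · obtain ⟨c, hc, htc⟩ := exists_lt_of_csInf_lt hne (lt_of_le_of_ne h (Ne.symm ht))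
      exact Or.inl (γ.isMaximal.ordConnected.out hc ha ⟨htc.le, hat⟩)
    · exact Or.inr h

end Orbit

end Riemannian

end FilippovSystem

/-- The measure on `ℝ` with density `2^{-|i|}` on `[i, i + 1]`. -/
def dyadicWeight : Measure ℝ :=
  Measure.sum fun i : ℤ ↦ (2⁻¹ : ℝ≥0∞) ^ i.natAbs • volume.restrict (Icc (i : ℝ) (i + 1))

theorem lintegral_dyadicWeight (f : ℝ → ℝ≥0∞) :
    ∫⁻ t, f t ∂dyadicWeight =
      ∑' i : ℤ, (2⁻¹ : ℝ≥0∞) ^ i.natAbs * ∫⁻ t in Icc (i : ℝ) (i + 1), f t := by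
  simp [dyadicWeight, lintegral_sum_measure, lintegral_smul_measure]

theorem dyadicWeight_Icc_pos {a b : ℝ} (hab : a < b) : 0 < dyadicWeight (Icc a b) := by
  have h1 : a < min b (⌊a⌋ + 1) := lt_min hab (Int.lt_floor_add_one a)
  refine lt_of_lt_of_le ?_ (Measure.le_sum_apply _ _)
  refine lt_of_lt_of_le ?_ (ENNReal.le_tsum ⌊a⌋)
  rw [Measure.smul_apply, smul_eq_mul, Measure.restrict_apply measurableSet_Icc]
  refine ENNReal.mul_pos (by simp) (ne_of_gt (lt_of_lt_of_le ?_
    (measure_mono (s := Icc a (min b (⌊a⌋ + 1))) fun t ht ↦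
      ⟨⟨ht.1, ht.2.trans (min_le_left _ _)⟩, (Int.floor_le a).trans ht.1,
        ht.2.trans (min_le_right _ _)⟩)))
  rw [Real.volume_Icc, ENNReal.ofReal_pos]
  linarith

theorem lintegral_dyadicWeight_affine_ne_top {A B : ℝ} (hB : 0 ≤ B) :
    ∫⁻ t, ENNReal.ofReal (A + B * |t|) ∂dyadicWeight ≠ ⊤ := by
  have hsum : Summable fun i : ℤ ↦ (2⁻¹ : ℝ) ^ i.natAbs * (A + B * (i.natAbs + 1)) := by
    have hnat : Summable fun n : ℕ ↦ (2⁻¹ : ℝ) ^ n * (A + B * (n + 1)) := by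
      have h0 := (summable_geometric_of_lt_one (r := (2⁻¹ : ℝ)) (by norm_num) (by norm_num)).mul_left
        (A + B)
      have h1 := (summable_pow_mul_geometric_of_norm_lt_one 1 (r := (2⁻¹ : ℝ))
        (by norm_num)).mul_left B
      refine (h0.add h1).congr fun n ↦ ?_
      ring
    refine Summable.of_nat_of_neg ?_ ?_ <;> simpa using hnat
  rw [lintegral_dyadicWeight]
  refine ne_top_of_le_ne_top hsum.tsum_ofReal_ne_top (ENNReal.tsum_le_tsum fun i ↦ ?_)
  have h2 : (2⁻¹ : ℝ≥0∞) ^ i.natAbs = ENNReal.ofReal ((2⁻¹ : ℝ) ^ i.natAbs) := by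
    rw [ENNReal.ofReal_pow (by norm_num), ENNReal.ofReal_inv_of_pos (by norm_num),
      ENNReal.ofReal_ofNat]
  rw [h2, ENNReal.ofReal_mul (by positivity)]
  gcongr
  refine (setLIntegral_mono' measurableSet_Icc (g := fun _ ↦
    ENNReal.ofReal (A + B * (i.natAbs + 1))) fun t ht ↦ ?_).trans (by simp)
  gcongr
  have h3 : ((i.natAbs : ℕ) : ℝ) = |(i : ℝ)| := by rw [Nat.cast_natAbs, Int.cast_abs]
  rw [h3]
  calc |t| = |(i : ℝ) + (t - i)| := by ring_nf
    _ ≤ |(i : ℝ)| + |t - i| := abs_add_le _ _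
    _ ≤ |(i : ℝ)| + 1 := by
      gcongr
      rw [abs_of_nonneg (by linarith [ht.1])]
      linarith [ht.2]

namespace FilippovSystem

section Riemannian

variable {E : Type*} [NormedAddCommGroup E] [NormedSpace ℝ E] {H : Type*} [TopologicalSpace H]
  {I : ModelWithCorners ℝ E H} {M : Type*} [MetricSpace M] [ChartedSpace H M] [IsManifold I 1 M]
  [Bundle.RiemannianBundle (fun x : M ↦ TangentSpace I x)]
  [IsContinuousRiemannianBundle E (fun x : M ↦ TangentSpace I x)]
  [IsRiemannianManifold I M]
  {r : ℕ∞} {Z : FilippovSystem I M r} {C : ℝ≥0}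

namespace Orbit

omit [Bundle.RiemannianBundle (fun x : M ↦ TangentSpace I x)]
  [IsContinuousRiemannianBundle E (fun x : M ↦ TangentSpace I x)]
  [IsRiemannianManifold I M] in
theorem edist_eq_lintegral (γ₀ γ₁ : Z.Orbit) :
    edist γ₀ γ₁ = ∫⁻ t, edist (γ₀.curve t) (γ₁.curve t) ∂dyadicWeight :=
  (lintegral_dyadicWeight _).symm

theorem uniformContinuous_eval (hC : ∀ p, ∀ v ∈ Z.field p, ‖v‖ ≤ C) (t : ℝ) :
    UniformContinuous fun γ : Z.Orbit ↦ γ.curve t := by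
  rw [EMetric.uniformContinuous_iff]
  intro ε hε
  obtain ⟨e, he0, heε⟩ : ∃ e : ℝ, 0 < e ∧ ENNReal.ofReal e ≤ ε := by
    rcases eq_or_ne ε ⊤ with rfl | h
    · exact ⟨1, one_pos, le_top⟩
    · exact ⟨ε.toReal, ENNReal.toReal_pos hε.ne' h, ENNReal.ofReal_toReal_le⟩
  set K : ℝ≥0 := 2 * (C + 1) with hK
  have hK0 : (0 : ℝ) < K := by rw [hK]; positivity
  set η : ℝ := e / (4 * K) with hη
  have hη0 : 0 < η := by positivity
  refine ⟨ENNReal.ofReal (e / 2) * dyadicWeight (Icc t (t + η)),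
    ENNReal.mul_pos (by simpa using he0) (dyadicWeight_Icc_pos (by linarith)).ne', ?_⟩
  intro γ₀ γ₁ h
  by_contra! hge
  refine absurd h (not_lt.2 ?_)
  rw [edist_eq_lintegral, ← setLIntegral_const]
  refine (setLIntegral_mono' measurableSet_Icc fun s hs ↦ ?_).trans (setLIntegral_le_lintegral _ _)
  have h1 : e ≤ dist (γ₀.curve t) (γ₁.curve t) := by
    have := heε.trans hge
    rwa [edist_dist, ENNReal.ofReal_le_ofReal_iff dist_nonneg] at this
  rw [edist_dist]
  refine ENNReal.ofReal_le_ofReal ?_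
  have hst : dist t s ≤ η := by
    rw [dist_comm, Real.dist_eq, abs_of_nonneg (by linarith [hs.1])]
    linarith [hs.2]
  have h2 := (γ₀.lipschitzWith_curve hC).dist_le_mul t s
  have h3 := (γ₁.lipschitzWith_curve hC).dist_le_mul s t
  rw [dist_comm s t] at h3
  have h4 : (K : ℝ) * dist t s ≤ e / 4 := by
    calc (K : ℝ) * dist t s ≤ K * η := by gcongr
      _ = e / 4 := by rw [hη]; field_simp
  linarith [dist_triangle4 (γ₀.curve t) (γ₀.curve s) (γ₁.curve s) (γ₁.curve t)]

theorem tendsto_of_forall_tendsto (hC : ∀ p, ∀ v ∈ Z.field p, ‖v‖ ≤ C) {c : ℕ → Z.Orbit}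
    {γ : Z.Orbit} (h : ∀ t, Tendsto (fun n ↦ (c n).curve t) atTop (𝓝 (γ.curve t))) :
    Tendsto c atTop (𝓝 γ) := by
  rw [tendsto_iff_edist_tendsto_0]
  simp_rw [edist_eq_lintegral]
  obtain ⟨A, hA⟩ : ∃ A, ∀ n, dist ((c n).curve 0) (γ.curve 0) ≤ A := by
    obtain ⟨A, hA⟩ := (tendsto_iff_dist_tendsto_zero.1 (h 0)).bddAbove_range
    exact ⟨A, fun n ↦ hA (mem_range_self n)⟩
  have hlim := tendsto_lintegral_of_dominated_convergence (μ := dyadicWeight)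
    (F := fun n t ↦ edist ((c n).curve t) (γ.curve t)) (f := fun _ ↦ 0)
    (fun t ↦ ENNReal.ofReal (A + (2 * (2 * (C + 1))) * |t|))
    (fun n ↦ ((c n).continuous_curve.edist γ.continuous_curve).measurable)
    (fun n ↦ Eventually.of_forall fun t ↦ ?_)
    (lintegral_dyadicWeight_affine_ne_top (by positivity))
    (Eventually.of_forall fun t ↦ tendsto_iff_edist_tendsto_0.1 (h t))
  · simpa using hlim
  · simp only
    rw [edist_dist]
    refine ENNReal.ofReal_le_ofReal ?_
    have h2 := ((c n).lipschitzWith_curve hC).dist_le_mul t 0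
    have h3 := (γ.lipschitzWith_curve hC).dist_le_mul 0 t
    rw [dist_comm 0 t] at h3
    push_cast at h2 h3
    rw [Real.dist_0_eq_abs] at h2 h3
    linarith [dist_triangle4 ((c n).curve t) ((c n).curve 0) (γ.curve 0) (γ.curve t), hA n]

theorem tendsto_iff_forall_tendsto (hC : ∀ p, ∀ v ∈ Z.field p, ‖v‖ ≤ C) {c : ℕ → Z.Orbit}
    {γ : Z.Orbit} : Tendsto c atTop (𝓝 γ) ↔
      ∀ t, Tendsto (fun n ↦ (c n).curve t) atTop (𝓝 (γ.curve t)) :=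
  ⟨fun h t ↦ ((uniformContinuous_eval hC t).continuous.tendsto γ).comp h,
    tendsto_of_forall_tendsto hC⟩

theorem continuous_orbitFlow (hC : ∀ p, ∀ v ∈ Z.field p, ‖v‖ ≤ C) (t : ℝ) :
    Continuous (Z.orbitFlow t) := by
  refine continuous_iff_seqContinuous.2 fun c γ h ↦ ?_
  exact tendsto_of_forall_tendsto hC fun s ↦ (tendsto_iff_forall_tendsto hC).1 h (t + s)

omit [Bundle.RiemannianBundle (fun x : M ↦ TangentSpace I x)]
  [IsContinuousRiemannianBundle E (fun x : M ↦ TangentSpace I x)]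
  [IsRiemannianManifold I M] in
theorem orbitFlow_orbitFlow (s t : ℝ) (γ : Z.Orbit) :
    Z.orbitFlow s (Z.orbitFlow t γ) = Z.orbitFlow (t + s) γ := by
  ext x
  · simp [orbitFlow, add_assoc]
  · simp [orbitFlow, add_assoc]

omit [Bundle.RiemannianBundle (fun x : M ↦ TangentSpace I x)]
  [IsContinuousRiemannianBundle E (fun x : M ↦ TangentSpace I x)]
  [IsRiemannianManifold I M] in
theorem orbitFlow_zero (γ : Z.Orbit) : Z.orbitFlow 0 γ = γ := by
  ext x <;> simp [orbitFlow]

theorem secondCountableTopology (hC : ∀ p, ∀ v ∈ Z.field p, ‖v‖ ≤ C)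
    [SecondCountableTopology M] : SecondCountableTopology Z.Orbit := by
  let e : Z.Orbit → C(ℝ, M) := fun γ ↦ ⟨γ.curve, γ.continuous_curve⟩
  have : TopologicalSpace.SeparableSpace Z.Orbit := by
    obtain ⟨s, hs, hsd⟩ := TopologicalSpace.exists_countable_dense (range e)
    choose f hf using fun x : range e ↦ x.2
    refine ⟨f '' s, hs.image f, fun γ ↦ ?_⟩
    obtain ⟨x, hxs, hx⟩ := mem_closure_iff_seq_limit.1 (hsd ⟨e γ, mem_range_self γ⟩)
    refine mem_closure_iff_seq_limit.2 ⟨fun n ↦ f (x n), fun n ↦ mem_image_of_mem f (hxs n),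
      tendsto_of_forall_tendsto hC fun t ↦ ?_⟩
    have h1 : Tendsto (fun n ↦ (x n : C(ℝ, M)) t) atTop (𝓝 (γ.curve t)) :=
      (((continuous_eval_const t).comp continuous_subtype_val).tendsto _).comp hx
    refine h1.congr fun n ↦ ?_
    rw [← hf (x n)]
    rfl
  exact UniformSpace.secondCountable_of_separable _

end Orbit

end Riemannian

end FilippovSystem

namespace FilippovSystem

section Riemannian

variable {E : Type*} [NormedAddCommGroup E] [NormedSpace ℝ E] [FiniteDimensional ℝ E]
  {H : Type*} [TopologicalSpace H]
  {I : ModelWithCorners ℝ E H} {M : Type*} [MetricSpace M] [ChartedSpace H M] [IsManifold I 1 M]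
  [Bundle.RiemannianBundle (fun x : M ↦ TangentSpace I x)]
  [IsContinuousRiemannianBundle E (fun x : M ↦ TangentSpace I x)]
  [IsRiemannianManifold I M]
  {r : ℕ∞} {Z : FilippovSystem I M r} {C : ℝ≥0}

namespace Orbit

section Limits

variable {ι : Type*} {l : Filter ι} {c : ι → Z.Orbit} {γ : Z.Orbit} {a b β ε : ℝ} {p : M}

theorem zero_mem_field_of_frequently (hC : ∀ p, ∀ v ∈ Z.field p, ‖v‖ ≤ C)
    (hlim : ∀ t, Tendsto (fun n ↦ (c n).curve t) l (𝓝 (γ.curve t))) (hab : a < b)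
    (hfreq : ∃ᶠ n in l, Icc a b ⊆ (c n).domain) (hp : ∀ t ∈ Icc a b, γ.curve t = p) :
    (0 : TangentSpace I p) ∈ Z.field p := by
  let l' := l ⊓ 𝓟 {n | Icc a b ⊆ (c n).domain}
  have : l'.NeBot := frequently_mem_iff_neBot.1 hfreq
  have hsol : Z.IsSolutionOn γ.curve (Icc a b) := by
    refine isSolutionOn_of_tendsto hC (l := l') (c := fun n ↦ (c n).curve) ?_
      fun t _ ↦ (hlim t).mono_left inf_le_left
    filter_upwards [mem_inf_of_right (mem_principal_self _)] with n hn
    exact (c n).isMaximal.isSolutionOn.mono (c n).isMaximal.ordConnected ordConnected_Icc hn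
  exact zero_mem_field hsol ordConnected_Icc hab Subset.rfl hp

omit [FiniteDimensional ℝ E] [Bundle.RiemannianBundle (fun x : M ↦ TangentSpace I x)]
  [IsContinuousRiemannianBundle E (fun x : M ↦ TangentSpace I x)]
  [IsRiemannianManifold I M] in
theorem curve_eq_of_frequently_eq (hlim : ∀ t, Tendsto (fun n ↦ (c n).curve t) l (𝓝 (γ.curve t)))
    (h : ∃ᶠ n in l, (c n).curve a = (c n).curve b) : γ.curve a = γ.curve b :=
  tendsto_nhds_unique_of_frequently_eq (hlim a) (hlim b) h

omit [FiniteDimensional ℝ E] [Bundle.RiemannianBundle (fun x : M ↦ TangentSpace I x)]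
  [IsContinuousRiemannianBundle E (fun x : M ↦ TangentSpace I x)]
  [IsRiemannianManifold I M] in
theorem zero_mem_field_of_mem_domain (γ : Z.Orbit) (ha : a ∈ γ.domain) (hb : b ∈ γ.domain)
    (hab : a < b) (hp : ∀ t ∈ Icc a b, γ.curve t = p) : (0 : TangentSpace I p) ∈ Z.field p :=
  zero_mem_field γ.isMaximal.isSolutionOn γ.isMaximal.ordConnected hab
    (γ.isMaximal.ordConnected.out ha hb) hp

theorem eventually_le_of_isLUB (hC : ∀ p, ∀ v ∈ Z.field p, ‖v‖ ≤ C)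
    (hlim : ∀ t, Tendsto (fun n ↦ (c n).curve t) l (𝓝 (γ.curve t))) (hβ : IsLUB γ.domain β)
    (hε : 0 < ε) : ∀ᶠ n in l, β + ε ∈ upperBounds (c n).domain := by
  by_contra hcon
  have h0 := γ.zero_notMem_field_of_mem_upperBounds hC hβ.1
  have hor : ∃ᶠ n in l, Icc (β + ε / 2) (β + ε) ⊆ (c n).domain ∨
      β + ε / 2 ∈ lowerBounds (c n).domain := by
    refine (not_eventually.1 hcon).mono fun n hn ↦ ?_
    by_contra! h
    refine h.1 ?_
    simp only [upperBounds, lowerBounds, mem_ofPred_eq, not_forall, not_le] at hn h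
    obtain ⟨x, hx, hxb⟩ := hn
    obtain ⟨-, y, hy, hyb⟩ := h
    exact (Icc_subset_Icc hyb.le hxb.le).trans ((c n).isMaximal.ordConnected.out hy hx)
  rcases frequently_or_distrib.1 hor with h | h
  · refine h0 (zero_mem_field_of_frequently hC hlim (by linarith) h fun t ht ↦ ?_)
    exact γ.stationary_after _ (fun x hx ↦ (hβ.1 hx).trans (by linarith [ht.1])) _ hβ.1
  · obtain ⟨x, hx, y, hy, hxy⟩ := γ.isMaximal.nontrivial.exists_lt
    refine h0 (γ.zero_mem_field_of_mem_domain hx hy hxy fun t ht ↦ ?_)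
    have htβ := ht.2.trans (hβ.1 hy)
    refine curve_eq_of_frequently_eq hlim (h.mono fun n hn ↦ ?_)
    exact (c n).stationary_before _ (fun z hz ↦ by linarith [hn hz]) _
      fun z hz ↦ by linarith [hn hz]

omit [FiniteDimensional ℝ E] in
theorem eventually_lt_of_isLUB (hC : ∀ p, ∀ v ∈ Z.field p, ‖v‖ ≤ C)
    (hlim : ∀ t, Tendsto (fun n ↦ (c n).curve t) l (𝓝 (γ.curve t))) (hβ : IsLUB γ.domain β)
    (hε : 0 < ε) : ∀ᶠ n in l, β - ε ∉ upperBounds (c n).domain := by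
  by_contra hcon
  have h : ∃ᶠ n in l, β - ε ∈ upperBounds (c n).domain := by
    simpa only [not_eventually, not_not] using hcon
  have hconst : ∀ t, β - ε ≤ t → γ.curve t = γ.curve β := fun t ht ↦
    curve_eq_of_frequently_eq hlim (h.mono fun n hn ↦
      (c n).stationary_after _ (fun z hz ↦ (hn hz).trans ht) _
        fun z hz ↦ by linarith [hn hz])
  have h0 := γ.zero_notMem_field_of_mem_upperBounds hC hβ.1
  obtain ⟨x, hx, hx', -⟩ := hβ.exists_between (show β - ε < β by linarith)
  obtain ⟨y, hy, hyx⟩ := γ.isMaximal.nontrivial.exists_ne x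
  rcases lt_or_gt_of_ne hyx with h1 | h1
  · have hm : max y (β - ε) < x := max_lt h1 hx'
    exact h0 (γ.zero_mem_field_of_mem_domain
      (γ.isMaximal.ordConnected.out hy hx ⟨le_max_left _ _, hm.le⟩) hx hm
      fun t ht ↦ hconst t ((le_max_right _ _).trans ht.1))
  · exact h0 (γ.zero_mem_field_of_mem_domain hx hy h1 fun t ht ↦ hconst t (hx'.le.trans ht.1))

theorem eventually_le_of_isGLB (hC : ∀ p, ∀ v ∈ Z.field p, ‖v‖ ≤ C)
    (hlim : ∀ t, Tendsto (fun n ↦ (c n).curve t) l (𝓝 (γ.curve t))) (hβ : IsGLB γ.domain β)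
    (hε : 0 < ε) : ∀ᶠ n in l, β - ε ∈ lowerBounds (c n).domain := by
  by_contra hcon
  have h0 := γ.zero_notMem_field_of_mem_lowerBounds hC hβ.1
  have hor : ∃ᶠ n in l, Icc (β - ε) (β - ε / 2) ⊆ (c n).domain ∨
      β - ε / 2 ∈ upperBounds (c n).domain := by
    refine (not_eventually.1 hcon).mono fun n hn ↦ ?_
    by_contra! h
    refine h.1 ?_
    simp only [upperBounds, lowerBounds, mem_ofPred_eq, not_forall, not_le] at hn h
    obtain ⟨x, hx, hxb⟩ := hn
    obtain ⟨-, y, hy, hyb⟩ := h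
    exact (Icc_subset_Icc hxb.le hyb.le).trans ((c n).isMaximal.ordConnected.out hx hy)
  rcases frequently_or_distrib.1 hor with h | h
  · refine h0 (zero_mem_field_of_frequently hC hlim (by linarith) h fun t ht ↦ ?_)
    exact γ.stationary_before _ (fun x hx ↦ by linarith [hβ.1 hx, ht.2]) _ hβ.1
  · obtain ⟨x, hx, y, hy, hxy⟩ := γ.isMaximal.nontrivial.exists_lt
    refine h0 (γ.zero_mem_field_of_mem_domain hx hy hxy fun t ht ↦ ?_)
    have htβ := (hβ.1 hx).trans ht.1
    refine curve_eq_of_frequently_eq hlim (h.mono fun n hn ↦ ?_)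
    exact (c n).stationary_after _ (fun z hz ↦ by linarith [hn hz]) _
      fun z hz ↦ by linarith [hn hz]

omit [FiniteDimensional ℝ E] in
theorem eventually_lt_of_isGLB (hC : ∀ p, ∀ v ∈ Z.field p, ‖v‖ ≤ C)
    (hlim : ∀ t, Tendsto (fun n ↦ (c n).curve t) l (𝓝 (γ.curve t))) (hβ : IsGLB γ.domain β)
    (hε : 0 < ε) : ∀ᶠ n in l, β + ε ∉ lowerBounds (c n).domain := by
  by_contra hcon
  have h : ∃ᶠ n in l, β + ε ∈ lowerBounds (c n).domain := by
    simpa only [not_eventually, not_not] using hcon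
  have hconst : ∀ t, t ≤ β + ε → γ.curve t = γ.curve β := fun t ht ↦
    curve_eq_of_frequently_eq hlim (h.mono fun n hn ↦
      (c n).stationary_before _ (fun z hz ↦ ht.trans (hn hz)) _
        fun z hz ↦ by linarith [hn hz])
  have h0 := γ.zero_notMem_field_of_mem_lowerBounds hC hβ.1
  obtain ⟨x, hx, -, hx'⟩ := hβ.exists_between (show β < β + ε by linarith)
  obtain ⟨y, hy, hyx⟩ := γ.isMaximal.nontrivial.exists_ne x
  rcases lt_or_gt_of_ne hyx with h1 | h1
  · exact h0 (γ.zero_mem_field_of_mem_domain hy hx h1 fun t ht ↦ hconst t (ht.2.trans hx'.le))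
  · have hm : x < min y (β + ε) := lt_min h1 hx'
    exact h0 (γ.zero_mem_field_of_mem_domain hx
      (γ.isMaximal.ordConnected.out hx hy ⟨hm.le, min_le_left _ _⟩) hm
      fun t ht ↦ hconst t (ht.2.trans (min_le_right _ _)))

end Limits

omit [FiniteDimensional ℝ E] in
theorem tendsto_curve_nhds (hC : ∀ p, ∀ v ∈ Z.field p, ‖v‖ ≤ C) (γ : Z.Orbit) (t : ℝ) :
    Tendsto (fun γ' : Z.Orbit ↦ γ'.curve t) (𝓝 γ) (𝓝 (γ.curve t)) :=
  (uniformContinuous_eval hC t).continuous.tendsto γ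

omit [FiniteDimensional ℝ E] in
/-- If orbits near `γ` satisfy a property that is lost for good after time one, then the flow is not
topologically transitive. -/
theorem not_isTopologicallyTransitiveFlow_of_eventually
    (hC : ∀ p, ∀ v ∈ Z.field p, ‖v‖ ≤ C) {γ : Z.Orbit} {P : Z.Orbit → Prop}
    (hP : ∀ᶠ γ' in 𝓝 γ, P γ') (hret : ∀ γ' t, 1 < t → P γ' → ¬ P (Z.orbitFlow t γ')) :
    ¬ IsTopologicallyTransitiveFlow Z.orbitFlow := by
  intro h
  obtain ⟨U, hU, hUo, hγU⟩ := _root_.mem_nhds_iff.1 hP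
  obtain ⟨t, ht, -, ⟨α, hα, rfl⟩, hαU⟩ := h (Z.orbitFlow (-1) ⁻¹' U) U
    (hUo.preimage (continuous_orbitFlow hC _)) hUo
    ⟨Z.orbitFlow 1 γ, by simpa [orbitFlow_orbitFlow, orbitFlow_zero] using hγU⟩ ⟨γ, hγU⟩
  refine hret _ (1 + t) (by linarith) (hU hα) (hU ?_)
  rw [orbitFlow_orbitFlow]
  simpa using hαU

theorem domain_eq_univ_of_isTopologicallyTransitiveFlow
    (hC : ∀ p, ∀ v ∈ Z.field p, ‖v‖ ≤ C) (h : IsTopologicallyTransitiveFlow Z.orbitFlow)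
    (γ : Z.Orbit) : γ.domain = univ := by
  have hne := γ.isMaximal.nontrivial.nonempty
  refine eq_univ_of_forall fun b ↦ γ.isMaximal.ordConnected.mem_of_notMem_bounds ?_ ?_
  · intro hb
    have hβ := isLUB_csSup hne ⟨b, hb⟩
    refine not_isTopologicallyTransitiveFlow_of_eventually hC
      ((eventually_le_of_isLUB hC (tendsto_curve_nhds hC γ) hβ (ε := 1 / 3) (by norm_num)).and
      (eventually_lt_of_isLUB hC (tendsto_curve_nhds hC γ) hβ (ε := 1 / 3) (by norm_num))) ?_ h
    rintro γ' t ht ⟨h1, -⟩ ⟨-, h2⟩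
    refine h2 fun s hs ↦ ?_
    linarith [h1 (a := t + s) hs]
  · intro hb
    have hβ := isGLB_csInf hne ⟨b, hb⟩
    refine not_isTopologicallyTransitiveFlow_of_eventually hC
      ((eventually_le_of_isGLB hC (tendsto_curve_nhds hC γ) hβ (ε := 1 / 3) (by norm_num)).and
      (eventually_lt_of_isGLB hC (tendsto_curve_nhds hC γ) hβ (ε := 1 / 3) (by norm_num))) ?_ h
    rintro γ' t ht ⟨-, h1⟩ ⟨h2, -⟩
    refine h1 fun s hs ↦ ?_
    have := h2 (a := s - t) (by simpa [orbitFlow] using hs)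
    linarith

/-- If all orbits are defined for all times, then the orbit space is complete. -/
theorem completeSpace [CompleteSpace M] (hC : ∀ p, ∀ v ∈ Z.field p, ‖v‖ ≤ C)
    (hdom : ∀ γ : Z.Orbit, γ.domain = univ) : CompleteSpace Z.Orbit := by
  refine EMetric.complete_of_cauchySeq_tendsto fun c hc ↦ ?_
  choose γ hγ using fun t : ℝ ↦ cauchySeq_tendsto_of_complete
    ((uniformContinuous_eval hC t).comp_cauchySeq hc)
  have hlip : LipschitzOnWith (2 * (C + 1)) γ univ :=
    lipschitzOnWith_of_tendsto (l := atTop) (c := fun n ↦ (c n).curve)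
      (.of_forall fun n ↦ ((c n).lipschitzWith_curve hC).lipschitzOnWith) fun t _ ↦ hγ t
  have hsol : Z.IsSolutionOn γ univ := by
    refine isSolutionOn_of_forall_Icc hC ordConnected_univ fun a _ b _ _ ↦
      isSolutionOn_of_tendsto hC (l := atTop) (c := fun n ↦ (c n).curve)
        (.of_forall fun n ↦ ?_) fun t _ ↦ hγ t
    exact (c n).isMaximal.isSolutionOn.mono (c n).isMaximal.ordConnected ordConnected_Icc
      (by simp [hdom])
  refine ⟨⟨univ, γ, ⟨ordConnected_univ, nontrivial_univ, hsol, fun _ _ _ _ _ _ ↦ subset_univ _⟩,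
    continuousOn_univ.1 hlip.continuousOn, fun s hs ↦ ?_, fun s hs ↦ ?_⟩,
    tendsto_of_forall_tendsto hC hγ⟩
  · linarith [hs (mem_univ (s + 1))]
  · linarith [hs (mem_univ (s - 1))]

theorem isTransitiveFlow_of_isTopologicallyTransitiveFlow [CompleteSpace M]
    [SecondCountableTopology M] [Nonempty Z.Orbit] (hC : ∀ p, ∀ v ∈ Z.field p, ‖v‖ ≤ C)
    (h : IsTopologicallyTransitiveFlow Z.orbitFlow) : IsTransitiveFlow Z.orbitFlow := by
  have := completeSpace hC (domain_eq_univ_of_isTopologicallyTransitiveFlow hC h)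
  have := secondCountableTopology hC (Z := Z)
  let B := TopologicalSpace.countableBasis Z.Orbit
  have hB := TopologicalSpace.isBasis_countableBasis Z.Orbit
  have hcount : B.Countable := TopologicalSpace.countable_countableBasis Z.Orbit
  have hdense : Dense (⋂ V ∈ B, ⋃ t ∈ Ioi (0 : ℝ), Z.orbitFlow t ⁻¹' V) := by
    refine dense_biInter_of_isOpen (fun V hV ↦ isOpen_biUnion fun t _ ↦
      (hB.isOpen hV).preimage (continuous_orbitFlow hC t)) hcount fun V hV ↦ ?_
    refine dense_iff_inter_open.2 fun U hU hne ↦ ?_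
    obtain ⟨t, ht, -, ⟨x, hx, rfl⟩, hxV⟩ := h U V hU (hB.isOpen hV) hne
      (TopologicalSpace.nonempty_of_mem_countableBasis hV)
    exact ⟨x, hx, mem_biUnion (show t ∈ Ioi 0 from ht) hxV⟩
  obtain ⟨x, hx⟩ := hdense.nonempty
  refine ⟨x, hB.dense_iff.2 fun V hV _ ↦ ?_⟩
  obtain ⟨t, ht, hxt⟩ := mem_iUnion₂.1 (mem_iInter₂.1 hx V hV)
  exact ⟨_, hxt, mem_image_of_mem _ (mem_Ici.2 (le_of_lt (mem_Ioi.1 ht)))⟩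

omit [FiniteDimensional ℝ E] in
theorem isTopologicallyTransitiveFlow_of_isTransitiveFlow
    (hC : ∀ p, ∀ v ∈ Z.field p, ‖v‖ ≤ C) (h : IsTransitiveFlow Z.orbitFlow) :
    IsTopologicallyTransitiveFlow Z.orbitFlow := by
  obtain ⟨x, hx⟩ := h
  intro U V hU hV hUne hVne
  obtain ⟨-, hsU, s, hs, rfl⟩ := hx.inter_open_nonempty U hU hUne
  obtain ⟨y, hy⟩ := hVne
  obtain ⟨-, huV, u, hu, rfl⟩ := hx.inter_open_nonempty (Z.orbitFlow (s + 1) ⁻¹' V)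
    (hV.preimage (continuous_orbitFlow hC _))
    ⟨Z.orbitFlow (-(s + 1)) y, by
      simpa only [mem_preimage, orbitFlow_orbitFlow, neg_add_cancel, orbitFlow_zero] using hy⟩
  refine ⟨u + 1, by linarith [mem_Ici.1 hu], _, mem_image_of_mem _ hsU, ?_⟩
  rw [mem_preimage, orbitFlow_orbitFlow] at huV
  rw [orbitFlow_orbitFlow]
  convert huV using 2
  ring

end Orbit

end Riemannian

end FilippovSystem

theorem lipschitzOnWith_Icc_of_eventually_dist_le {X : Type*} [PseudoMetricSpace X] {γ : ℝ → X}
    {K : ℝ≥0} {a b : ℝ}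
    (h : ∀ t ∈ Icc a b, ∀ᶠ s in 𝓝 t, dist (γ s) (γ t) ≤ K * |s - t|) :
    LipschitzOnWith K γ (Icc a b) := by
  have hcont : ContinuousOn γ (Icc a b) := fun t ht ↦ by
    refine ContinuousAt.continuousWithinAt (tendsto_iff_dist_tendsto_zero.2 ?_)
    refine squeeze_zero' (.of_forall fun _ ↦ dist_nonneg) (h t ht) ?_
    have : Continuous fun s : ℝ ↦ (K : ℝ) * |s - t| := by fun_prop
    simpa using this.tendsto t
  suffices key : ∀ s ∈ Icc a b, ∀ t ∈ Icc a b, s ≤ t → dist (γ s) (γ t) ≤ K * (t - s) by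
    refine LipschitzOnWith.of_dist_le_mul fun s hs t ht ↦ ?_
    rcases le_total s t with hst | hst
    · rw [dist_comm s, Real.dist_eq, abs_of_nonneg (sub_nonneg.2 hst)]
      exact key s hs t ht hst
    · rw [dist_comm, Real.dist_eq, abs_of_nonneg (sub_nonneg.2 hst)]
      exact key t ht s hs hst
  intro s hs t ht hst
  have hsub : Icc s t ⊆ Icc a b := Icc_subset_Icc hs.1 ht.2
  have hB : ∀ x, HasDerivAt (fun x : ℝ ↦ (K : ℝ) * (x - s)) K x := fun x ↦ by
    simpa using ((hasDerivAt_id x).sub_const s).const_mul (K : ℝ)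
  refine image_le_of_liminf_slope_right_le_deriv_boundary (f := fun x ↦ dist (γ s) (γ x))
    (B := fun x ↦ K * (x - s)) (B' := fun _ ↦ K)
    ((continuous_const.dist continuous_id).comp_continuousOn (hcont.mono hsub)) (by simp) (by fun_prop)
    (fun x _ ↦ (hB x).hasDerivWithinAt) (fun x hx r hr ↦ Eventually.frequently ?_) ⟨hst, le_rfl⟩
  filter_upwards [nhdsWithin_le_nhds (h x (hsub (Ico_subset_Icc_self hx))), self_mem_nhdsWithin]
    with z hz hxz
  refine lt_of_le_of_lt ?_ hr
  rw [slope_def_field, div_le_iff₀ (sub_pos.2 hxz)]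
  rw [abs_of_pos (sub_pos.2 hxz)] at hz
  linarith [dist_triangle (γ s) (γ x) (γ z), dist_comm (γ x) (γ z)]

/-- A Lipschitz map to a complete space extends to the closure of its domain. -/
theorem LipschitzOnWith.exists_extension_closure {X Y : Type*} [PseudoMetricSpace X] [MetricSpace Y]
    [CompleteSpace Y] {f : X → Y} {K : ℝ≥0} {s : Set X} (hf : LipschitzOnWith K f s) :
    ∃ g : X → Y, LipschitzOnWith K g (closure s) ∧ EqOn g f s := by
  have hex : ∀ x : X, ∃ y, x ∈ closure s → ∃ u : ℕ → X, (∀ n, u n ∈ s) ∧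
      Tendsto u atTop (𝓝 x) ∧ Tendsto (f ∘ u) atTop (𝓝 y) := by
    intro x
    by_cases hx : x ∈ closure s
    · obtain ⟨u, hus, hu⟩ := mem_closure_iff_seq_limit.1 hx
      obtain ⟨y, hy⟩ := cauchySeq_tendsto_of_complete
        (hf.cauchySeq_comp hu.cauchySeq (range_subset_iff.2 hus))
      exact ⟨y, fun _ ↦ ⟨u, hus, hu, hy⟩⟩
    · exact ⟨f x, fun h ↦ absurd h hx⟩
  choose g hg using hex
  refine ⟨g, LipschitzOnWith.of_dist_le_mul fun x hx y hy ↦ ?_, fun x hx ↦ ?_⟩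
  · obtain ⟨u, hus, hu, hu'⟩ := hg x hx
    obtain ⟨v, hvs, hv, hv'⟩ := hg y hy
    exact le_of_tendsto_of_tendsto' (hu'.dist hv') ((hu.dist hv).const_mul _)
      fun n ↦ hf.dist_le_mul _ (hus n) _ (hvs n)
  · obtain ⟨u, hus, hu, hu'⟩ := hg x (subset_closure hx)
    have h1 : Tendsto (f ∘ u) atTop (𝓝 (f x)) :=
      (hf.continuousOn x hx).tendsto.comp
        (tendsto_nhdsWithin_iff.2 ⟨hu, .of_forall hus⟩)
    exact tendsto_nhds_unique hu' h1

theorem exists_isInteriorPoint {E : Type*} [NormedAddCommGroup E] [NormedSpace ℝ E] {H : Type*}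
    [TopologicalSpace H] (I : ModelWithCorners ℝ E H) (M : Type*) [TopologicalSpace M]
    [ChartedSpace H M] [IsManifold I 1 M] [Nonempty M] : ∃ p : M, I.IsInteriorPoint p := by
  obtain ⟨x⟩ := ‹Nonempty M›
  obtain ⟨z, hz⟩ := interior_extChartAt_target_nonempty I x
  have hzt := interior_subset hz
  refine ⟨(extChartAt I x).symm z, (I.isInteriorPoint_iff_of_mem_atlas (n := 1) one_ne_zero
    (chart_mem_atlas H x) (x := (extChartAt I x).symm z) ?_).2 ?_⟩
  · rw [← extChartAt_source I]
    exact (extChartAt I x).map_target hzt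
  · change extChartAt I x ((extChartAt I x).symm z) ∈ _
    rw [(extChartAt I x).right_inv hzt]
    exact hz

namespace FilippovSystem

section Manifold

variable {E : Type*} [NormedAddCommGroup E] [NormedSpace ℝ E]
  {H : Type*} [TopologicalSpace H]
  {I : ModelWithCorners ℝ E H} {M : Type*} [MetricSpace M] [ChartedSpace H M] [IsManifold I 1 M]
  {r : ℕ∞}

theorem exists_isInteriorPoint_h_ne_zero [Nonempty M] (Z : FilippovSystem I M r) :
    ∃ p, I.IsInteriorPoint p ∧ Z.h p ≠ 0 := by
  obtain ⟨p, hp⟩ := exists_isInteriorPoint I M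
  by_contra! hcon
  refine Z.regular_h p (hcon p hp) ?_
  have h0 : Z.h =ᶠ[𝓝 p] fun _ ↦ 0 := by
    filter_upwards [(I.isOpen_interior (n := 1) one_ne_zero).mem_nhds hp] with y hy using hcon y hy
  rw [h0.mfderiv_eq, mfderiv_const]
  rfl

theorem Zplus_mem_field (Z : FilippovSystem I M r) {p : M} (hp : 0 < Z.h p) :
    Z.Zplus p ∈ Z.field p := by
  refine ⟨1, by simp [multiSign, hp], ?_⟩
  module

theorem Zminus_mem_field (Z : FilippovSystem I M r) {p : M} (hp : Z.h p < 0) :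
    Z.Zminus p ∈ Z.field p := by
  refine ⟨-1, by simp [multiSign, hp, hp.not_gt], ?_⟩
  module

theorem exists_eventually_solvesAt [CompleteSpace E] [Nonempty M] (hr : 1 ≤ r)
    (Z : FilippovSystem I M r) : ∃ γ : ℝ → M, ∀ᶠ t in 𝓝 0, Z.SolvesAt γ t := by
  obtain ⟨p, hp, hne⟩ := Z.exists_isInteriorPoint_h_ne_zero
  have hr' : (1 : WithTop ℕ∞) ≤ r := by exact_mod_cast hr
  have hcont := Z.contMDiff_h.continuous
  rcases hne.lt_or_gt with h | h
  · obtain ⟨γ, hγ0, hγ⟩ := exists_isMIntegralCurveAt_of_contMDiffAt 0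
      (Z.contMDiff_Zminus.of_le hr' p) hp
    have hneg : ∀ᶠ t in 𝓝 0, Z.h (γ t) < 0 :=
      (hcont.continuousAt.comp hγ.continuousAt).eventually_lt_const (by simpa [hγ0] using h)
    refine ⟨γ, ?_⟩
    filter_upwards [hγ, hneg] with t ht hlt using ⟨_, Z.Zminus_mem_field hlt, ht⟩
  · obtain ⟨γ, hγ0, hγ⟩ := exists_isMIntegralCurveAt_of_contMDiffAt 0
      (Z.contMDiff_Zplus.of_le hr' p) hp
    have hpos : ∀ᶠ t in 𝓝 0, 0 < Z.h (γ t) :=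
      (hcont.continuousAt.comp hγ.continuousAt).eventually_const_lt (by simpa [hγ0] using h)
    refine ⟨γ, ?_⟩
    filter_upwards [hγ, hpos] with t ht hlt using ⟨_, Z.Zplus_mem_field hlt, ht⟩

theorem IsMaximalSolutionOn.congr {Z : FilippovSystem I M r} {γ γ' : ℝ → M} {J : Set ℝ}
    (h : Z.IsMaximalSolutionOn γ J) (heq : EqOn γ' γ J) : Z.IsMaximalSolutionOn γ' J where
  ordConnected := h.ordConnected
  nontrivial := h.nontrivial
  isSolutionOn := h.isSolutionOn.congr h.ordConnected heq
  maximal γ'' J' hJ' hsub hsol heq' := h.maximal γ'' J' hJ' hsub hsol (heq.symm.trans heq')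

end Manifold

section Riemannian

variable {E : Type*} [NormedAddCommGroup E] [NormedSpace ℝ E]
  {H : Type*} [TopologicalSpace H]
  {I : ModelWithCorners ℝ E H} {M : Type*} [MetricSpace M] [ChartedSpace H M] [IsManifold I 1 M]
  [Bundle.RiemannianBundle (fun x : M ↦ TangentSpace I x)]
  [IsContinuousRiemannianBundle E (fun x : M ↦ TangentSpace I x)]
  [IsRiemannianManifold I M]
  {r : ℕ∞} {Z : FilippovSystem I M r} {C : ℝ≥0} {γ : ℝ → M} {J : Set ℝ}

/-- Every solution extends to a maximal solution. -/
theorem IsSolutionOn.exists_isMaximalSolutionOn (hC : ∀ p, ∀ v ∈ Z.field p, ‖v‖ ≤ C)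
    (hJ : J.OrdConnected) (hJn : J.Nontrivial) (hγ : Z.IsSolutionOn γ J) :
    ∃ (γ' : ℝ → M) (J' : Set ℝ), Z.IsMaximalSolutionOn γ' J' := by
  let α := {x : Set ℝ × (ℝ → M) // x.1.OrdConnected ∧ x.1.Nontrivial ∧ Z.IsSolutionOn x.2 x.1}
  let R : α → α → Prop := fun x y ↦ x.1.1 ⊆ y.1.1 ∧ EqOn x.1.2 y.1.2 x.1.1
  have hrefl : Std.Refl R := ⟨fun x ↦ ⟨Subset.rfl, fun _ _ ↦ rfl⟩⟩
  have hzorn : ∃ m : α, ∀ x, R m x → R x m := by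
    refine exists_maximal_of_chains_bounded (fun c hc ↦ ?_) fun {x y z} hxy hyz ↦
      ⟨hxy.1.trans hyz.1, fun t ht ↦ (hxy.2 ht).trans (hyz.2 (hxy.1 ht))⟩
    rcases c.eq_empty_or_nonempty with rfl | ⟨x₀, hx₀⟩
    · exact ⟨⟨(J, γ), hJ, hJn, hγ⟩, by simp⟩
    classical
    let U : Set ℝ := ⋃ x ∈ c, x.1.1
    let g : ℝ → M := fun t ↦ if h : ∃ x ∈ c, t ∈ x.1.1 then h.choose.1.2 t else γ t
    have hg : ∀ x ∈ c, EqOn g x.1.2 x.1.1 := by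
      intro x hx t ht
      have hex : ∃ x ∈ c, t ∈ x.1.1 := ⟨x, hx, ht⟩
      have hgt : g t = hex.choose.1.2 t := dif_pos hex
      rw [hgt]
      rcases hc.total hex.choose_spec.1 hx with h | h
      · exact h.2 hex.choose_spec.2
      · exact (h.2 ht).symm
    have hcommon : ∀ a ∈ U, ∀ b ∈ U, ∃ x ∈ c, a ∈ x.1.1 ∧ b ∈ x.1.1 := by
      intro a ha b hb
      obtain ⟨x, hx, hax⟩ := mem_iUnion₂.1 ha
      obtain ⟨y, hy, hby⟩ := mem_iUnion₂.1 hb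
      rcases hc.total hx hy with h | h
      · exact ⟨y, hy, h.1 hax, hby⟩
      · exact ⟨x, hx, hax, h.1 hby⟩
    have hsubU : ∀ x ∈ c, x.1.1 ⊆ U := fun x hx ↦ subset_biUnion_of_mem (u := fun x : α ↦ x.1.1) hx
    have hU : U.OrdConnected := by
      refine ⟨fun a ha b hb ↦ ?_⟩
      obtain ⟨x, hx, hax, hbx⟩ := hcommon a ha b hb
      exact (x.2.1.out hax hbx).trans (hsubU x hx)
    have hsol : Z.IsSolutionOn g U := by
      refine isSolutionOn_of_forall_Icc hC hU fun a ha b hb _ ↦ ?_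
      obtain ⟨x, hx, hax, hbx⟩ := hcommon a ha b hb
      have hsub := x.2.1.out hax hbx
      exact (x.2.2.2.mono x.2.1 ordConnected_Icc hsub).congr ordConnected_Icc ((hg x hx).mono hsub)
    exact ⟨⟨(U, g), hU, x₀.2.2.1.mono (hsubU x₀ hx₀), hsol⟩,
      fun x hx ↦ ⟨hsubU x hx, (hg x hx).symm⟩⟩
  obtain ⟨⟨⟨J', γ'⟩, h1, h2, h3⟩, hmax⟩ := hzorn
  exact ⟨γ', J', h1, h2, h3, fun γ'' J'' hJ'' hsub hsol heq ↦
    (hmax ⟨(J'', γ''), hJ'', h2.mono hsub, hsol⟩ ⟨hsub, heq⟩).1⟩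

/-- The interval of definition of a maximal solution is closed. -/
theorem IsMaximalSolutionOn.isClosed [CompleteSpace M] (hC : ∀ p, ∀ v ∈ Z.field p, ‖v‖ ≤ C)
    (h : Z.IsMaximalSolutionOn γ J) : IsClosed J := by
  have hsol := (isSolutionOn_iff hC h.ordConnected).1 h.isSolutionOn
  obtain ⟨g, hg, heq⟩ := hsol.1.exists_extension_closure
  have hcl : (closure J).OrdConnected := h.ordConnected.convex.closure.ordConnected
  refine isClosed_of_closure_subset (h.maximal g (closure J) hcl subset_closure ?_ heq.symm)
  refine (isSolutionOn_iff hC hcl).2 ⟨hg, ?_⟩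
  have hfr := measure_eq_zero_iff_ae_notMem.1 (h.ordConnected.convex.addHaar_frontier volume)
  filter_upwards [hsol.2, hfr] with t ht htfr htcl
  have hti : t ∈ interior J := by
    by_contra hcon
    exact htfr ⟨interior_subset htcl, hcon⟩
  exact (ht hti).congr (heq.eventuallyEq_of_mem (mem_interior_iff_mem_nhds.1 hti))

theorem IsMaximalSolutionOn.nonempty_orbit [CompleteSpace M]
    (hC : ∀ p, ∀ v ∈ Z.field p, ‖v‖ ≤ C) (h : Z.IsMaximalSolutionOn γ J) : Nonempty Z.Orbit := by
  have hne := h.nontrivial.nonempty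
  have hlip := ((isSolutionOn_iff hC h.ordConnected).1 h.isSolutionOn).1
  refine ⟨⟨J, γ ∘ intervalClamp J, h.congr fun t ht ↦ ?_, ?_, fun s hs t ht ↦ ?_,
    fun s hs t ht ↦ ?_⟩⟩
  · simp [intervalClamp_of_mem ht]
  · exact hlip.continuousOn.comp_continuous
      (lipschitzWith_intervalClamp h.ordConnected hne).continuous fun t ↦
        (h.isClosed hC).closure_subset (intervalClamp_mem_closure h.ordConnected hne t)
  · simp [intervalClamp_of_mem_upperBounds hs, intervalClamp_of_mem_upperBounds ht]
  · simp [intervalClamp_of_mem_lowerBounds h.nontrivial hs,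
      intervalClamp_of_mem_lowerBounds h.nontrivial ht]

theorem nonempty_orbit [CompleteSpace E] [CompleteSpace M] [Nonempty M] (hr : 1 ≤ r)
    (hC : ∀ p, ∀ v ∈ Z.field p, ‖v‖ ≤ C) : Nonempty Z.Orbit := by
  obtain ⟨γ, hγ⟩ := Z.exists_eventually_solvesAt hr
  obtain ⟨a, b, -, hnhds, hsub⟩ := exists_Icc_mem_subset_of_mem_nhds hγ
  have hsol : Z.IsSolutionOn γ (Icc a b) := by
    refine (isSolutionOn_iff hC ordConnected_Icc).2
      ⟨lipschitzOnWith_Icc_of_eventually_dist_le fun t ht ↦ ?_,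
        .of_forall fun t ht ↦ hsub (interior_subset ht)⟩
    obtain ⟨v, hv, hd⟩ := hsub ht
    simpa using hd.eventually_dist_le (hC _ v hv)
  have hnt : (Icc a b).Nontrivial := (infinite_of_mem_nhds 0 hnhds).nontrivial
  obtain ⟨γ', J', h⟩ := hsol.exists_isMaximalSolutionOn hC ordConnected_Icc hnt
  exact h.nonempty_orbit hC

end Riemannian

end FilippovSystem

end

theorem mainTheorem2 {E : Type*} [NormedAddCommGroup E] [NormedSpace ℝ E] [FiniteDimensional ℝ E]
    {H : Type*} [TopologicalSpace H] {I : ModelWithCorners ℝ E H}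
    {M : Type*} [MetricSpace M] [ChartedSpace H M] [IsManifold I ∞ M]
    [Bundle.RiemannianBundle (fun x : M ↦ TangentSpace I x)]
    [IsContMDiffRiemannianBundle I ∞ E (fun x : M ↦ TangentSpace I x)]
    [IsRiemannianManifold I M]
    [ConnectedSpace M] [SecondCountableTopology M] [CompleteSpace M]
    {r : ℕ∞} (hr : 1 ≤ r) (Z : FilippovSystem I M r) (hZ : Z.IsBounded) :
    IsTopologicallyTransitiveFlow Z.orbitFlow ↔ IsTransitiveFlow Z.orbitFlow := by
  have := isContinuousRiemannianBundle_of_isContMDiffRiemannianBundle I M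
  obtain ⟨C, hC⟩ := hZ
  have hC' : ∀ p, ∀ v ∈ Z.field p, ‖v‖ ≤ C.toNNReal := fun p v hv ↦
    (hC p v hv).trans (Real.le_coe_toNNReal C)
  have : CompleteSpace E := FiniteDimensional.complete ℝ E
  have := FilippovSystem.nonempty_orbit hr hC'
  exact ⟨FilippovSystem.Orbit.isTransitiveFlow_of_isTopologicallyTransitiveFlow hC',
    FilippovSystem.Orbit.isTopologicallyTransitiveFlow_of_isTransitiveFlow hC'⟩
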